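/- Let $S$ and $X=(X_1,\dots,X_N)$ be jointly distributed discrete random variables with finite alphabets $\mathcal S$ and $\mathcal X_1\times\cdots\times\mathcal X_N$, and let $f:\mathcal X_1\times\cdots\times\mathcal X_N\to\mathbb R$ and $h:\mathcal X_1\times\cdots\times\mathcal X_N\to\mathbb R^K$ be arbitrary functions. Entropies $H$ and mutual informations $I$ are in bits and $\log=\log_2$. For $\epsilon\ge 0$ put $$h_\epsilon(P_{S,f(X),h(X)})=\sup\{\,I(h(X);U)\;:\;P_{U|S,f(X),h(X)}\text{ with } I(U;S)\le\epsilon\,\},$$ where $U=f(X)+M$ ranges over the real-valued discrete random variables, given by an arbitrary conditional distribution given $(S,f(X),h(X))$ (the noise $M=U-f(X)$ is arbitrary). Let $\mathcal K_S$ be the set of separations of $S$, i.e. of pairs $(S_1,S_2)=(g_1(S),g_2(S))$ that determine $S$ and satisfy $2\le|\mathcal S_1|<|\mathcal S|$ and $2\le|\mathcal S_2|<|\mathcal S|$, where $|\mathcal S|,|\mathcal S_1|,|\mathcal S_2|$ are the numbers of values taken with positive probability by $S,S_1,S_2$. Let $\alpha=\epsilon/H(S)$ and, for $(S_1,S_2)\in\mathcal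 K_S$, $\alpha_2=\epsilon/H(S_2)$. **Theorem.** Let $0\le\epsilon<I(S;h(X))$. Then $$\max_{i\in\{1,\dots,4\}}L_h^i(\epsilon)\;\le\; h_\epsilon(P_{S,f(X),h(X)})\;\le\; H(h(X)|S)+\epsilon,$$ where $$\begin{aligned} L_h^1(\epsilon)&=H(h(X)|S)-H(S|h(X))+\epsilon=H(h(X))-H(S)+\epsilon,\\ L_h^2(\epsilon)&=H(h(X)|S)-\alpha H(S|h(X))+\epsilon-(1-\alpha)\bigl(\log(I(S;h(X))+1)+4\bigr),\\ L_h^3(\epsilon)&=H(h(X)|S)+\epsilon-\bigl(\log(I(S;h(X))+1)+4\bigr)-\min_{(S_1,S_2)\in\mathcal K_S}\alpha_2H(S_2|h(X)),\\ L_h^4(\epsilon)&=H(h(X)|S)+\epsilon-\bigl(\log(I(S;h(X))+1)+4\bigr)-\min_{(S_1,S_2)\in\mathcal K_S,\ \alpha_2\le 1}\alpha_2\bigl(H(S|h(X))-\log(I(S;h(X))+1)-4\bigr), \end{aligned}$$ and $L_h^3$ (resp. $L_h^4$) is left out of the maximum if the set over which its minimum is taken is empty. If $H(S|h(X))=0$,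 that is, if $S$ is almost surely a deterministic function of $h(X)$, then the lower bound is tight: $h_\epsilon(P_{S,f(X),h(X)})=L_h^1(\epsilon)=H(h(X)|S)+\epsilon$. Conversely, if $L_h^1(\epsilon)$ is tight, i.e. $h_\epsilon(P_{S,f(X),h(X)})=L_h^1(\epsilon)$, then $H(S|h(X))=0$. -/

import Mathlib

namespace SemPriv

noncomputable section

variable {α β 𝒮 𝒵 : Type*}

/-! Information measures of discrete laws, in bits. A `PMF` has countable support, so the sums below
range over countably many nonzero terms; where they are used, at least one of the two random
variables takes finitely many values, and then they converge absolutely. -/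

/-- Shannon entropy `H(A)` of a random variable `A` with law `p`. -/
def entropy (p : PMF α) : ℝ :=
  ∑' a, (p a).toReal * Real.logb 2 (1 / (p a).toReal)

/-- Conditional entropy `H(A | B)`, where `p` is the joint law of `(A, B)`. -/
def condEntropy (p : PMF (α × β)) : ℝ :=
  ∑' ab : α × β, (p ab).toReal * Real.logb 2 ((p.map Prod.snd ab.2).toReal / (p ab).toReal)

/-- Mutual information `I(A; B)`, where `p` is the joint law of `(A, B)`. -/
def mutualInfo (p : PMF (α × β)) : ℝ :=
  ∑' ab : α × β, (p ab).toReal *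
    Real.logb 2 ((p ab).toReal / ((p.map Prod.fst ab.1).toReal * (p.map Prod.snd ab.2).toReal))

/-- The law `P_{S, f(X), h(X)}` obtained from the law `P` of `(S, X)`. -/
def semanticLaw {𝒳 : Type*} (P : PMF (𝒮 × 𝒳)) (f : 𝒳 → ℝ) (h : 𝒳 → 𝒵) : PMF (𝒮 × ℝ × 𝒵) :=
  P.map fun sx => (sx.1, f sx.2, h sx.2)

/-! In what follows `p` is the law `P_{S, f(X), h(X)}`. -/

/-- `H(S)`. -/
def entS (p : PMF (𝒮 × ℝ × 𝒵)) : ℝ := entropy (p.map fun t => t.1)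

/-- `H(h(X))`. -/
def entH (p : PMF (𝒮 × ℝ × 𝒵)) : ℝ := entropy (p.map fun t => t.2.2)

/-- `H(h(X) | S)`. -/
def entHGivenS (p : PMF (𝒮 × ℝ × 𝒵)) : ℝ := condEntropy (p.map fun t => (t.2.2, t.1))

/-- `H(S | h(X))`. -/
def entSGivenH (p : PMF (𝒮 × ℝ × 𝒵)) : ℝ := condEntropy (p.map fun t => (t.1, t.2.2))

/-- `I(S; h(X))`. -/
def infoSH (p : PMF (𝒮 × ℝ × 𝒵)) : ℝ := mutualInfo (p.map fun t => (t.1, t.2.2))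

/-- The joint law of `((S, f(X), h(X)), U)` when the disclosed real-valued discrete random variable
`U` has conditional law `Q = P_{U | S, f(X), h(X)}`. -/
def disclosedLaw (p : PMF (𝒮 × ℝ × 𝒵)) (Q : 𝒮 × ℝ × 𝒵 → PMF ℝ) : PMF ((𝒮 × ℝ × 𝒵) × ℝ) :=
  p.bind fun t => (Q t).map fun u => (t, u)

/-- Every mechanism is of the form `U = f(X) + M`, for a discrete noise `M` with conditional law `W`
given `(S, f(X), h(X))`; hence that form does not restrict `Q`. -/
theorem exists_additive_noise (Q : 𝒮 × ℝ × 𝒵 → PMF ℝ) :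
    ∃ W : 𝒮 × ℝ × 𝒵 → PMF ℝ, ∀ t, Q t = (W t).map fun m => t.2.1 + m := by
  refine ⟨fun t => (Q t).map fun u => u - t.2.1, fun t => ?_⟩
  rw [PMF.map_comp]
  have : ((fun m => t.2.1 + m) ∘ fun u : ℝ => u - t.2.1) = id := by
    funext u
    simp
  rw [this, PMF.map_id]

/-- The leakage `I(S; U)` of a mechanism. -/
def leakage (p : PMF (𝒮 × ℝ × 𝒵)) (Q : 𝒮 × ℝ × 𝒵 → PMF ℝ) : ℝ :=
  mutualInfo ((disclosedLaw p Q).map fun tu => (tu.1.1, tu.2))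

/-- The utility `I(h(X); U)` of a mechanism. -/
def utility (p : PMF (𝒮 × ℝ × 𝒵)) (Q : 𝒮 × ℝ × 𝒵 → PMF ℝ) : ℝ :=
  mutualInfo ((disclosedLaw p Q).map fun tu => (tu.1.2.2, tu.2))

/-- The utilities of the mechanisms with leakage at most `ε`. -/
def achievable (ε : ℝ) (p : PMF (𝒮 × ℝ × 𝒵)) : Set ℝ :=
  {v | ∃ Q : 𝒮 × ℝ × 𝒵 → PMF ℝ, leakage p Q ≤ ε ∧ v = utility p Q}

/-- The optimal utility `h_ε(P_{S, f(X), h(X)})`. -/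
def optUtility (ε : ℝ) (p : PMF (𝒮 × ℝ × 𝒵)) : ℝ := sSup (achievable ε p)

/-- A pair of labellings of the alphabet of `S`, read as a pair of random variables
`(S₁, S₂) = (g₁(S), g₂(S))`. Only pairs with less than `|𝒮|` values each are used below, and these
can be labelled by numbers less than `|𝒮|`. -/
abbrev Labelling (𝒮 : Type*) [Fintype 𝒮] :=
  (𝒮 → Fin (Fintype.card 𝒮)) × (𝒮 → Fin (Fintype.card 𝒮))

open Classical in
/-- The set `𝒦_S` of separations `S = (S₁, S₂)`: the pair `(S₁, S₂)` determines `S`, and each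
component takes at least two values but fewer values than `S` does. Values are counted if they
have positive probability. -/
def separations [Fintype 𝒮] (p : PMF (𝒮 × ℝ × 𝒵)) : Finset (Labelling 𝒮) :=
  Finset.univ.filter fun g =>
    let supp := (p.map fun t => t.1).support
    Set.InjOn (fun s => (g.1 s, g.2 s)) supp ∧
      2 ≤ (g.1 '' supp).ncard ∧ (g.1 '' supp).ncard < supp.ncard ∧
      2 ≤ (g.2 '' supp).ncard ∧ (g.2 '' supp).ncard < supp.ncard

/-- `H(S₂)`. -/
def entS₂ [Fintype 𝒮] (p : PMF (𝒮 × ℝ × 𝒵)) (g : Labelling 𝒮) : ℝ :=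
  entropy (p.map fun t => g.2 t.1)

/-- `H(S₂ | h(X))`. -/
def entS₂GivenH [Fintype 𝒮] (p : PMF (𝒮 × ℝ × 𝒵)) (g : Labelling 𝒮) : ℝ :=
  condEntropy (p.map fun t => (g.2 t.1, t.2.2))

open Classical in
/-- The separations for which `ε / H(S₂)` is a probability, so that randomized response over `S₂`
with this parameter exists. -/
def admissibleSeparations [Fintype 𝒮] (ε : ℝ) (p : PMF (𝒮 × ℝ × 𝒵)) : Finset (Labelling 𝒮) :=
  (separations p).filter fun g => ε / entS₂ p g ≤ 1

/-- `log (I(S; h(X)) + 1) + 4`. -/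
def gap (p : PMF (𝒮 × ℝ × 𝒵)) : ℝ := Real.logb 2 (infoSH p + 1) + 4

def L1 (ε : ℝ) (p : PMF (𝒮 × ℝ × 𝒵)) : ℝ := entHGivenS p - entSGivenH p + ε

def L2 (ε : ℝ) (p : PMF (𝒮 × ℝ × 𝒵)) : ℝ :=
  entHGivenS p - (ε / entS p) * entSGivenH p + ε - (1 - ε / entS p) * gap p

/-- `Finset.inf'` is the minimum over a nonempty finite set. -/
def L3 [Fintype 𝒮] (ε : ℝ) (p : PMF (𝒮 × ℝ × 𝒵)) (hne : (separations p).Nonempty) : ℝ :=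
  entHGivenS p + ε - gap p -
    (separations p).inf' hne fun g => (ε / entS₂ p g) * entS₂GivenH p g

def L4 [Fintype 𝒮] (ε : ℝ) (p : PMF (𝒮 × ℝ × 𝒵)) (hne : (admissibleSeparations ε p).Nonempty) :
    ℝ :=
  entHGivenS p + ε - gap p -
    (admissibleSeparations ε p).inf' hne fun g => (ε / entS₂ p g) * (entSGivenH p - gap p)

end

end SemPriv

namespace SemPriv

open Finset

variable {α β γ δ Ω A B V : Type*}

/-! ### Discrete laws -/

/-! Write A = S, B = h(X), I = I(A;B). Since B takes finitely many values, the law of (A, B) is a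
finite matrix of weights `w a b`.

Upper bound: I(B;U) = I(A;U) + I(B;U|A) - I(A;U|B) ≤ I(A;U) + H(B|A). This is
`mutualInfo_le_add_condEntropy`, proved message by message because U may take infinitely many
values.

Lower bounds: a single family of mechanisms suffices. Realize B as Z(A), where Z is a random
function independent of A (`IsCoupling`). With probability β = ε/I reveal B, otherwise reveal Z. The
leakage is βI = ε and the utility is H(B) - (1-β)H(Z(A)|Z) = H(B|A) + ε - (1-β)(cost - I), where
cost = H(Z(A)|Z); see `mem_achievable_of_isCoupling`. Always cost ≤ H(A) = I + H(A|B), which gives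
`L1`. The strong functional representation lemma `exists_coupling_cost_le` gives a Z with cost ≤ I +
log(I+1) + 4. Then `L2` follows because ε/H(A) ≤ β, `L3` because the minimum in it is nonnegative,
and `L4` because it never exceeds the better of the two preceding bounds. No mechanism based on a
separation is needed.

Functional representation: run one exponential clock per letter of B. For each a, the race weighted
by the conditional law `Q a` has a winner with law `Q a`, and all these races share the same clocks.
Given that y wins race a, the mean rank of y in the race weighted by the marginal P of B is at most
1 + Q a y / P y (`exists_race`). By Jensen's inequality the expected log rank is at most I + 1.
Given the clocks, the rank is an injective integer label of Z(A), and Zipf coding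
(`weightEntropy_le_zipf`) turns this into the entropy bound.

Converse: if H(A|B) > 0, some letter b is compatible with two values of A. The coupling with
independent coordinates gives positive mass to a function that merges them, so cost < H(A) and the
utility exceeds `L1` (`exists_coupling_cost_lt`). -/

theorem map_apply_of_injective (p : PMF α) {e : α → β} (he : e.Injective) (a : α) :
    p.map e (e a) = p a := by
  classical
  rw [PMF.map_apply, tsum_eq_single a]
  · simp
  · intro b hb
    rw [if_neg fun h => hb (he h).symm]

theorem map_apply_of_notMem_range (p : PMF α) {e : α → β} {b : β} (hb : b ∉ Set.range e) :
    p.map e b = 0 := by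
  rw [PMF.apply_eq_zero_iff, PMF.support_map]
  exact fun h => hb (Set.image_subset_range _ _ h)

theorem tsum_map_of_injective (p : PMF α) {e : α → β} (he : e.Injective) (F : β → ℝ) :
    ∑' b, (p.map e b).toReal * F b = ∑' a, (p a).toReal * F (e a) := by
  rw [← he.tsum_eq (f := fun b => (p.map e b).toReal * F b)]
  · simp only [map_apply_of_injective p he]
  · intro b hb
    by_contra h
    exact hb (by simp [map_apply_of_notMem_range p h])

theorem entropy_map_of_injective (p : PMF α) {e : α → β} (he : e.Injective) :
    entropy (p.map e) = entropy p := by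
  unfold entropy
  rw [tsum_map_of_injective p he]
  simp only [map_apply_of_injective p he]

theorem map_prodMap_fst (p : PMF (α × β)) (e : α → γ) (e' : β → δ) :
    (p.map (Prod.map e e')).map Prod.fst = (p.map Prod.fst).map e := by
  simp only [PMF.map_comp]
  rfl

theorem map_prodMap_snd (p : PMF (α × β)) (e : α → γ) (e' : β → δ) :
    (p.map (Prod.map e e')).map Prod.snd = (p.map Prod.snd).map e' := by
  simp only [PMF.map_comp]
  rfl

theorem mutualInfo_map_of_injective (p : PMF (α × β)) {e : α → γ} {e' : β → δ}
    (he : e.Injective) (he' : e'.Injective) :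
    mutualInfo (p.map (Prod.map e e')) = mutualInfo p := by
  unfold mutualInfo
  rw [tsum_map_of_injective p (he.prodMap he')]
  simp only [map_apply_of_injective p (he.prodMap he'), map_prodMap_fst, map_prodMap_snd,
    Prod.map_fst, Prod.map_snd, map_apply_of_injective _ he, map_apply_of_injective _ he']

theorem condEntropy_map_of_injective (p : PMF (α × β)) {e : α → γ} {e' : β → δ}
    (he : e.Injective) (he' : e'.Injective) :
    condEntropy (p.map (Prod.map e e')) = condEntropy p := by
  unfold condEntropy
  rw [tsum_map_of_injective p (he.prodMap he')]
  simp only [map_apply_of_injective p (he.prodMap he'), map_prodMap_snd,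
    Prod.map_snd, map_apply_of_injective _ he']

theorem toReal_le_one (p : PMF α) (a : α) : (p a).toReal ≤ 1 :=
  ENNReal.toReal_le_of_le_ofReal zero_le_one (by simpa using p.coe_le_one a)

theorem sum_toReal [Fintype α] (p : PMF α) : ∑ a, (p a).toReal = 1 := by
  have h := p.tsum_coe
  rw [tsum_fintype] at h
  rw [← ENNReal.toReal_sum fun a _ => p.apply_ne_top a, h, ENNReal.toReal_one]

theorem summable_toReal (p : PMF α) : Summable fun a => (p a).toReal :=
  ENNReal.summable_toReal (by simp [p.tsum_coe])

theorem apply_le_map_apply (p : PMF α) (g : α → β) (a : α) : p a ≤ p.map g (g a) := by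
  classical
  rw [PMF.map_apply]
  exact le_trans (by simp) (ENNReal.le_tsum (f := fun a' => if g a = g a' then p a' else 0) a)

theorem toReal_le_map_apply (p : PMF α) (g : α → β) (a : α) :
    (p a).toReal ≤ (p.map g (g a)).toReal :=
  ENNReal.toReal_mono (PMF.apply_ne_top _ _) (apply_le_map_apply p g a)

theorem entropy_nonneg (p : PMF α) : 0 ≤ entropy p := by
  refine tsum_nonneg fun a => ?_
  rcases eq_or_lt_of_le (ENNReal.toReal_nonneg (a := p a)) with h | h
  · simp [← h]
  · exact mul_nonneg h.le (Real.logb_nonneg one_lt_two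
      (by rw [le_div_iff₀ h]; simpa using toReal_le_one p a))

theorem condEntropy_nonneg (p : PMF (α × β)) : 0 ≤ condEntropy p := by
  refine tsum_nonneg fun a => ?_
  rcases eq_or_lt_of_le (ENNReal.toReal_nonneg (a := p a)) with h | h
  · simp [← h]
  · exact mul_nonneg h.le (Real.logb_nonneg one_lt_two
      (by rw [le_div_iff₀ h]; simpa using toReal_le_map_apply p Prod.snd a))

theorem map_fst_apply (p : PMF (α × β)) (a : α) : p.map Prod.fst a = ∑' b, p (a, b) := by
  classical
  rw [PMF.map_apply, ENNReal.tsum_prod', tsum_eq_single a]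
  · simp
  · intro a' ha'
    simp [ha'.symm]

theorem toReal_map_fst [Fintype B] (p : PMF (α × B)) (a : α) :
    (p.map Prod.fst a).toReal = ∑ b, (p (a, b)).toReal := by
  rw [map_fst_apply, tsum_fintype, ENNReal.toReal_sum fun b _ => p.apply_ne_top _]

theorem hasSum_toReal_map_fst (p : PMF (α × β)) (a : α) :
    HasSum (fun b => (p (a, b)).toReal) (p.map Prod.fst a).toReal := by
  have h := (p.map Prod.fst).apply_ne_top a
  rw [map_fst_apply] at h ⊢
  rw [ENNReal.tsum_toReal_eq fun b => p.apply_ne_top _]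
  exact ENNReal.hasSum_toReal h

theorem toReal_map_snd [Fintype A] (p : PMF (A × β)) (b : β) :
    (p.map Prod.snd b).toReal = ∑ a, (p (a, b)).toReal := by
  have : p.map Prod.snd = (p.map Prod.swap).map Prod.fst := by rw [PMF.map_comp]; rfl
  rw [this, toReal_map_fst]
  exact Finset.sum_congr rfl fun a _ => by
    rw [← map_apply_of_injective p Prod.swap_injective (a, b)]; rfl

/-! ### Information measures of weights on finite sets -/

/-- Entropy of a weight on a finite set. -/
noncomputable def weightEntropy [Fintype A] (m : A → ℝ) : ℝ :=
  ∑ a, m a * Real.logb 2 (1 / m a)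

/-- Conditional entropy of the column index given the row index. -/
noncomputable def weightCondEntropy [Fintype A] [Fintype B] (w : A → B → ℝ) : ℝ :=
  ∑ a, ∑ b, w a b * Real.logb 2 ((∑ b', w a b') / w a b)

/-- Mutual information of the row index and the column index. -/
noncomputable def weightInfo [Fintype A] [Fintype B] (w : A → B → ℝ) : ℝ :=
  ∑ a, ∑ b, w a b * Real.logb 2 (w a b / ((∑ b', w a b') * (∑ a', w a' b)))

theorem entropy_eq_weightEntropy [Fintype A] (p : PMF A) :
    entropy p = weightEntropy fun a => (p a).toReal := by
  rw [entropy, tsum_fintype]; rfl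

theorem mutualInfo_eq_weightInfo [Fintype A] [Fintype B] (p : PMF (A × B)) :
    mutualInfo p = weightInfo fun a b => (p (a, b)).toReal := by
  rw [mutualInfo, tsum_fintype, Fintype.sum_prod_type]
  simp only [toReal_map_fst, toReal_map_snd]
  rfl

theorem condEntropy_eq_weightCondEntropy [Fintype A] [Fintype B] (p : PMF (B × A)) :
    condEntropy p = weightCondEntropy fun a b => (p (b, a)).toReal := by
  rw [condEntropy, tsum_fintype, Fintype.sum_prod_type_right]
  simp only [toReal_map_snd]
  rfl

section weights

variable {w : A → B → ℝ}

theorem le_rowSum [Fintype B] (hw : ∀ a b, 0 ≤ w a b) (a : A) (b : B) : w a b ≤ ∑ b', w a b' :=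
  Finset.single_le_sum (f := w a) (fun b' _ => hw a b') (Finset.mem_univ b)

theorem le_colSum [Fintype A] (hw : ∀ a b, 0 ≤ w a b) (a : A) (b : B) : w a b ≤ ∑ a', w a' b :=
  Finset.single_le_sum (f := fun a' => w a' b) (fun a' _ => hw a' b) (Finset.mem_univ a)

theorem weightCondEntropy_term_nonneg [Fintype B] (hw : ∀ a b, 0 ≤ w a b) (a : A) (b : B) :
    0 ≤ w a b * Real.logb 2 ((∑ b', w a b') / w a b) := by
  rcases eq_or_lt_of_le (hw a b) with h | h
  · simp [← h]
  · exact mul_nonneg h.le (Real.logb_nonneg one_lt_two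
      (by rw [le_div_iff₀ h]; simpa using le_rowSum hw a b))

variable [Fintype A] [Fintype B]

theorem weightInfo_swap (w : A → B → ℝ) :
    weightInfo (fun b a => w a b) = weightInfo w := by
  unfold weightInfo
  rw [Finset.sum_comm]
  simp only [mul_comm]

theorem weightInfo_eq_sub (hw : ∀ a b, 0 ≤ w a b) :
    weightInfo w = weightEntropy (fun b => ∑ a, w a b) - weightCondEntropy w := by
  have hE : weightEntropy (fun b => ∑ a, w a b)
      = ∑ a, ∑ b, w a b * Real.logb 2 (1 / ∑ a', w a' b) := by
    rw [Finset.sum_comm]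
    exact Finset.sum_congr rfl fun b _ => Finset.sum_mul _ _ _
  rw [hE, weightInfo, weightCondEntropy, ← Finset.sum_sub_distrib]
  refine Finset.sum_congr rfl fun a _ => ?_
  rw [← Finset.sum_sub_distrib]
  refine Finset.sum_congr rfl fun b _ => ?_
  rcases eq_or_lt_of_le (hw a b) with h | h
  · simp [← h]
  have h1 := h.trans_le (le_rowSum hw a b)
  have h2 := h.trans_le (le_colSum hw a b)
  rw [Real.logb_div h.ne' (mul_pos h1 h2).ne', Real.logb_mul h1.ne' h2.ne',
    Real.logb_div h1.ne' h.ne', Real.logb_div one_ne_zero h2.ne', Real.logb_one]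
  ring

theorem weightInfo_eq_sub' (hw : ∀ a b, 0 ≤ w a b) :
    weightInfo w = weightEntropy (fun a => ∑ b, w a b) - weightCondEntropy (fun b a => w a b) := by
  rw [← weightInfo_swap, weightInfo_eq_sub fun b a => hw a b]

theorem weightCondEntropy_eq_zero_iff (hw : ∀ a b, 0 ≤ w a b) :
    weightCondEntropy w = 0 ↔ ∀ a b, 0 < w a b → w a b = ∑ b', w a b' := by
  unfold weightCondEntropy
  rw [Finset.sum_eq_zero_iff_of_nonneg fun a _ =>
    Finset.sum_nonneg fun b _ => weightCondEntropy_term_nonneg hw a b]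
  constructor
  · intro h a b hab
    have h1 := (Finset.sum_eq_zero_iff_of_nonneg
      fun b _ => weightCondEntropy_term_nonneg hw a b).1 (h a (mem_univ a)) b (mem_univ b)
    have h2 := (mul_eq_zero.1 h1).resolve_left hab.ne'
    have h3 : 0 < (∑ b', w a b') / w a b := div_pos (hab.trans_le (le_rowSum hw a b)) hab
    have h4 := (Real.logb_eq_zero.1 h2)
    rcases h4 with h4 | h4 | h4 | h4 | h4 | h4
    · norm_num at h4
    · norm_num at h4
    · norm_num at h4
    · exact absurd h4 h3.ne'
    · rw [div_eq_one_iff_eq hab.ne'] at h4; exact h4.symm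
    · linarith
  · intro h a _
    refine Finset.sum_eq_zero fun b _ => ?_
    rcases eq_or_lt_of_le (hw a b) with h0 | h0
    · simp [← h0]
    · rw [← h a b h0, div_self h0.ne']; simp

end weights

end SemPriv

namespace SemPriv

open Finset

variable {A B V : Type*} [Fintype A] [Fintype B]

/-! ### The upper bound on the utility -/

theorem logb_two_le_sub_one_div {x : ℝ} (hx : 0 < x) :
    Real.logb 2 x ≤ (x - 1) / Real.log 2 := by
  rw [Real.logb]
  exact div_le_div_of_nonneg_right (Real.log_le_sub_one_of_pos hx) (Real.log_nonneg one_le_two)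

/-- The contribution of one message v to I(B;V) ≤ I(A;V) + H(B|A), with `j a b` = P(a,b,v), `w a b`
= P(a,b) and t = P(v). The logarithms differ by that of P(b,v)P(a|b)/P(a,v), which log x ≤ (x-1)/ln
2 makes linear; the resulting error sums to at most 0. -/
theorem sum_info_le_add {j w : A → B → ℝ} (hj : ∀ a b, 0 ≤ j a b) (hjw : ∀ a b, j a b ≤ w a b) :
    ∑ b, (∑ a, j a b) * Real.logb 2 ((∑ a, j a b) / ((∑ a, w a b) * ∑ a, ∑ b, j a b)) ≤
      ∑ a, (∑ b, j a b) * Real.logb 2 ((∑ b, j a b) / ((∑ b, w a b) * ∑ a, ∑ b, j a b)) +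
      ∑ a, ∑ b, j a b * Real.logb 2 ((∑ b', w a b') / w a b) := by
  have hw : ∀ a b, 0 ≤ w a b := fun a b => (hj a b).trans (hjw a b)
  have hl : 0 < Real.log 2 := Real.log_pos one_lt_two
  set t := ∑ a, ∑ b, j a b with ht
  have key : ∀ a b, j a b * Real.logb 2 ((∑ a, j a b) / ((∑ a, w a b) * t)) ≤
      j a b * Real.logb 2 ((∑ b, j a b) / ((∑ b, w a b) * t)) +
      j a b * Real.logb 2 ((∑ b', w a b') / w a b) +
      ((∑ a', j a' b) * (w a b / ∑ a', w a' b) - j a b) / Real.log 2 := by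
    intro a b
    have hjB0 : 0 ≤ ∑ a', j a' b := Finset.sum_nonneg fun a' _ => hj a' b
    have hwB0 : 0 ≤ ∑ a', w a' b := Finset.sum_nonneg fun a' _ => hw a' b
    rcases eq_or_lt_of_le (hj a b) with h | h
    · simp only [← h, zero_mul, zero_add, sub_zero]
      exact div_nonneg (mul_nonneg hjB0 (div_nonneg (hw a b) hwB0)) hl.le
    have hjA := h.trans_le (le_rowSum hj a b)
    have hjB := h.trans_le (le_colSum hj a b)
    have hwab := h.trans_le (hjw a b)
    have hwA := hwab.trans_le (le_rowSum hw a b)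
    have hwB := hwab.trans_le (le_colSum hw a b)
    have htp : 0 < t := hjA.trans_le (Finset.single_le_sum (f := fun a => ∑ b, j a b)
      (fun a _ => Finset.sum_nonneg fun b _ => hj a b) (Finset.mem_univ a))
    have h1 : Real.logb 2 ((∑ a, j a b) / ((∑ a, w a b) * t)) =
        Real.logb 2 ((∑ b, j a b) / ((∑ b, w a b) * t)) +
        Real.logb 2 ((∑ b', w a b') / w a b) +
        Real.logb 2 ((∑ a', j a' b) * (w a b / ∑ a', w a' b) / ∑ b', j a b') := by
      rw [← Real.logb_mul (by positivity) (by positivity),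
        ← Real.logb_mul (by positivity) (by positivity)]
      congr 1
      field_simp
    have h2 := logb_two_le_sub_one_div (x := (∑ a', j a' b) * (w a b / ∑ a', w a' b) /
      ∑ b', j a b') (by positivity)
    have h3 : j a b * (((∑ a', j a' b) * (w a b / ∑ a', w a' b) / ∑ b', j a b' - 1)
        / Real.log 2) ≤ ((∑ a', j a' b) * (w a b / ∑ a', w a' b) - j a b) / Real.log 2 := by
      rw [← mul_div_assoc]
      refine div_le_div_of_nonneg_right ?_ hl.le
      -- This discards the factor P(b|a,v) ≤ 1, which removes the row sum from the denominator, so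
      -- that the error can be summed over a for fixed b.
      have : j a b / ∑ b', j a b' ≤ 1 := div_le_one_of_le₀ (le_rowSum hj a b) hjA.le
      have h4 : 0 ≤ (∑ a', j a' b) * (w a b / ∑ a', w a' b) := by positivity
      calc _ = (∑ a', j a' b) * (w a b / ∑ a', w a' b) * (j a b / ∑ b', j a b') - j a b := by ring
        _ ≤ _ := by nlinarith
    rw [h1]
    nlinarith [mul_le_mul_of_nonneg_left h2 h.le]
  have hB : ∑ b, (∑ a, j a b) * Real.logb 2 ((∑ a, j a b) / ((∑ a, w a b) * t)) =
      ∑ a, ∑ b, j a b * Real.logb 2 ((∑ a, j a b) / ((∑ a, w a b) * t)) := by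
    rw [Finset.sum_comm]
    exact Finset.sum_congr rfl fun b _ => Finset.sum_mul _ _ _
  have hA : ∑ a, (∑ b, j a b) * Real.logb 2 ((∑ b, j a b) / ((∑ b, w a b) * t)) =
      ∑ a, ∑ b, j a b * Real.logb 2 ((∑ b, j a b) / ((∑ b, w a b) * t)) :=
    Finset.sum_congr rfl fun b _ => Finset.sum_mul _ _ _
  have hle : ∑ a, ∑ b, ((∑ a', j a' b) * (w a b / ∑ a', w a' b) - j a b) / Real.log 2 ≤ 0 := by
    simp only [← Finset.sum_div, Finset.sum_sub_distrib]
    refine div_nonpos_of_nonpos_of_nonneg (sub_nonpos.2 ?_) hl.le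
    rw [Finset.sum_comm, Finset.sum_comm (f := j)]
    refine Finset.sum_le_sum fun b _ => ?_
    rw [← Finset.mul_sum, ← Finset.sum_div]
    exact mul_le_of_le_one_right (Finset.sum_nonneg fun a' _ => hj a' b) (div_self_le_one _)
  rw [hA, hB]
  refine (Finset.sum_le_sum fun a _ => Finset.sum_le_sum fun b _ => key a b).trans ?_
  simp only [Finset.sum_add_distrib]
  linarith

/-- The entropy of V may be infinite, so the terms are dominated directly: above by C p, since
p(a,v) ≤ p(v) and a has finitely many values, and in absolute value below zero by the product of the
marginals over ln 2. -/
theorem summable_mutualInfo (p : PMF (A × V)) : Summable fun x : A × V => (p x).toReal *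
    Real.logb 2 ((p x).toReal / ((p.map Prod.fst x.1).toReal * (p.map Prod.snd x.2).toReal)) := by
  have hl : 0 < Real.log 2 := Real.log_pos one_lt_two
  set C := ∑ a, |Real.logb 2 (1 / (p.map Prod.fst a).toReal)|
  have hs : Summable fun x : A × V => (p x).toReal * C +
      (p.map Prod.fst x.1).toReal * (p.map Prod.snd x.2).toReal / Real.log 2 :=
    ((summable_toReal p).mul_right C).add
      ((Summable.mul_of_nonneg (summable_toReal (p.map Prod.fst)) (summable_toReal (p.map Prod.snd))
        (fun _ => ENNReal.toReal_nonneg) (fun _ => ENNReal.toReal_nonneg)).div_const _)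
  refine Summable.of_norm_bounded hs fun ⟨a, v⟩ => ?_
  have hC : |Real.logb 2 (1 / (p.map Prod.fst a).toReal)| ≤ C :=
    Finset.single_le_sum (f := fun a => |Real.logb 2 (1 / (p.map Prod.fst a).toReal)|)
      (fun _ _ => abs_nonneg _) (Finset.mem_univ a)
  have hC0 : 0 ≤ C := (abs_nonneg _).trans hC
  have h1 := toReal_le_map_apply p Prod.fst (a, v)
  have h2 := toReal_le_map_apply p Prod.snd (a, v)
  simp only at h1 h2 ⊢
  set x := (p (a, v)).toReal
  set ma := (p.map Prod.fst a).toReal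
  set mv := (p.map Prod.snd v).toReal
  have hx : 0 ≤ x := ENNReal.toReal_nonneg
  rcases eq_or_lt_of_le hx with h | h
  · rw [← h]
    have : 0 ≤ ma * mv / Real.log 2 :=
      div_nonneg (mul_nonneg ENNReal.toReal_nonneg ENNReal.toReal_nonneg) hl.le
    simpa using this
  have ha := h.trans_le h1
  have hv := h.trans_le h2
  have hup : Real.logb 2 (x / (ma * mv)) ≤ C := by
    refine le_trans (Real.logb_le_logb_of_le one_lt_two (by positivity) ?_)
      ((le_abs_self _).trans hC)
    rw [div_le_div_iff₀ (by positivity) ha]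
    nlinarith
  have hlow : -Real.logb 2 (x / (ma * mv)) ≤ (ma * mv / x - 1) / Real.log 2 := by
    rw [← Real.logb_inv, inv_div]
    exact logb_two_le_sub_one_div (by positivity)
  have hlow' : x * -Real.logb 2 (x / (ma * mv)) ≤ (ma * mv - x) / Real.log 2 := by
    refine (mul_le_mul_of_nonneg_left hlow h.le).trans (le_of_eq ?_)
    field_simp
  have h5 : (ma * mv - x) / Real.log 2 ≤ ma * mv / Real.log 2 :=
    div_le_div_of_nonneg_right (by linarith) hl.le
  have h6 : 0 ≤ ma * mv / Real.log 2 := by positivity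
  have h7 : 0 ≤ x * C := by positivity
  rw [Real.norm_eq_abs, abs_le]
  constructor
  · linarith
  · nlinarith

theorem toReal_map_fst_thd {A : Type*} (J : PMF (A × B × V)) (a : A) (v : V) :
    ((J.map fun x => (x.1, x.2.2)) (a, v)).toReal = ∑ b, (J (a, b, v)).toReal := by
  have he : Function.Injective fun x : A × B × V => ((x.1, x.2.2), x.2.1) := by
    rintro ⟨a, b, v⟩ ⟨a', b', v'⟩ h
    simp_all
  have : (J.map fun x => (x.1, x.2.2)) = (J.map fun x => ((x.1, x.2.2), x.2.1)).map Prod.fst := by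
    rw [PMF.map_comp]; rfl
  rw [this, toReal_map_fst]
  exact Finset.sum_congr rfl fun b _ =>
    congrArg ENNReal.toReal (map_apply_of_injective J he (a, b, v))

/-- All three quantities are series over the messages v; for H(B|A) this is P(a,b) = ∑ P(a,b,v).
They are compared term by term with `sum_info_le_add`. -/
theorem mutualInfo_le_add_condEntropy (J : PMF (A × B × V)) :
    mutualInfo (J.map fun x => (x.2.1, x.2.2)) ≤
      mutualInfo (J.map fun x => (x.1, x.2.2)) + condEntropy (J.map fun x => (x.2.1, x.1)) := by
  set j : V → A → B → ℝ := fun v a b => (J (a, b, v)).toReal with hjdef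
  set w : A → B → ℝ := fun a b => ((J.map fun x => (x.2.1, x.1)) (b, a)).toReal with hwdef
  have hj : ∀ v a b, 0 ≤ j v a b := fun v a b => ENNReal.toReal_nonneg
  have hAV : ∀ a v, ((J.map fun x => (x.1, x.2.2)) (a, v)).toReal = ∑ b, j v a b :=
    toReal_map_fst_thd J
  have hBV : ∀ b v, ((J.map fun x => (x.2.1, x.2.2)) (b, v)).toReal = ∑ a, j v a b :=
    fun b v => toReal_map_snd J (b, v)
  have hw : ∀ a b, HasSum (fun v => j v a b) (w a b) := by
    intro a b
    have he : Function.Injective fun x : A × B × V => ((x.2.1, x.1), x.2.2) := by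
      rintro ⟨a, b, v⟩ ⟨a', b', v'⟩ h
      simp_all
    have : (J.map fun x => (x.2.1, x.1)) = (J.map fun x => ((x.2.1, x.1), x.2.2)).map Prod.fst := by
      rw [PMF.map_comp]; rfl
    have h := hasSum_toReal_map_fst (J.map fun x => ((x.2.1, x.1), x.2.2)) (b, a)
    rw [← this] at h
    refine h.congr_fun fun v => ?_
    exact congrArg ENNReal.toReal (map_apply_of_injective J he (a, b, v)).symm
  have hjw : ∀ v a b, j v a b ≤ w a b := fun v a b =>
    le_hasSum (hw a b) v fun v' _ => hj v' a b
  have hA : ∀ a, (((J.map fun x => (x.1, x.2.2)).map Prod.fst) a).toReal = ∑ b, w a b := by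
    intro a
    have : (J.map fun x => (x.1, x.2.2)).map Prod.fst
        = (J.map fun x => (x.2.1, x.1)).map Prod.snd := by
      rw [PMF.map_comp, PMF.map_comp]; rfl
    rw [this, toReal_map_snd]
  have hB : ∀ b, (((J.map fun x => (x.2.1, x.2.2)).map Prod.fst) b).toReal = ∑ a, w a b := by
    intro b
    have : (J.map fun x => (x.2.1, x.2.2)).map Prod.fst
        = (J.map fun x => (x.2.1, x.1)).map Prod.fst := by
      rw [PMF.map_comp, PMF.map_comp]; rfl
    rw [this, toReal_map_fst]
  have hAV' : ∀ v, (((J.map fun x => (x.1, x.2.2)).map Prod.snd) v).toReal =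
      ∑ a, ∑ b, j v a b := by
    intro v
    rw [toReal_map_snd]
    exact Finset.sum_congr rfl fun a _ => hAV a v
  have hBV' : ∀ v, (((J.map fun x => (x.2.1, x.2.2)).map Prod.snd) v).toReal =
      ∑ a, ∑ b, j v a b := by
    intro v
    rw [toReal_map_snd, Finset.sum_comm]
    exact Finset.sum_congr rfl fun a _ => hBV a v
  have sA := summable_mutualInfo (J.map fun x => (x.1, x.2.2))
  have sB := summable_mutualInfo (J.map fun x => (x.2.1, x.2.2))
  have iA : HasSum (fun v => ∑ a, (∑ b, j v a b) *
      Real.logb 2 ((∑ b, j v a b) / ((∑ b, w a b) * ∑ a, ∑ b, j v a b)))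
      (mutualInfo (J.map fun x => (x.1, x.2.2))) := by
    have h := ((Equiv.prodComm V A).hasSum_iff.2 sA.hasSum).prod_fiberwise
      (fun v => hasSum_fintype _)
    unfold mutualInfo
    simpa only [Function.comp_apply, Equiv.prodComm_apply, Prod.swap_prod_mk, hAV, hA, hAV']
      using h
  have iB : HasSum (fun v => ∑ b, (∑ a, j v a b) *
      Real.logb 2 ((∑ a, j v a b) / ((∑ a, w a b) * ∑ a, ∑ b, j v a b)))
      (mutualInfo (J.map fun x => (x.2.1, x.2.2))) := by
    have h := ((Equiv.prodComm V B).hasSum_iff.2 sB.hasSum).prod_fiberwise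
      (fun v => hasSum_fintype _)
    unfold mutualInfo
    simpa only [Function.comp_apply, Equiv.prodComm_apply, Prod.swap_prod_mk, hBV, hB, hBV']
      using h
  have iC : HasSum (fun v => ∑ a, ∑ b, j v a b * Real.logb 2 ((∑ b', w a b') / w a b))
      (condEntropy (J.map fun x => (x.2.1, x.1))) := by
    rw [condEntropy_eq_weightCondEntropy]
    exact hasSum_sum fun a _ => hasSum_sum fun b _ => (hw a b).mul_right _
  exact hasSum_le (fun v => sum_info_le_add (hj v) (hjw v)) iB (iA.add iC)

end SemPriv

namespace SemPriv

open Finset MeasureTheory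

/-! ### Exponential races -/

/-- The exponential law with rate one. -/
noncomputable def expLaw : Measure ℝ :=
  (volume.restrict (Set.Ioi 0)).withDensity fun t => ENNReal.ofReal (Real.exp (-t))

theorem lintegral_rpow_mul_exp_neg {a r : ℝ} (ha : 0 < a) (hr : 0 < r) :
    ∫⁻ t in Set.Ioi (0 : ℝ), ENNReal.ofReal (t ^ (a - 1) * Real.exp (-(r * t))) =
      ENNReal.ofReal ((1 / r) ^ a * Real.Gamma a) := by
  have h := Real.integral_rpow_mul_exp_neg_mul_Ioi ha hr
  rw [← h, ofReal_integral_eq_lintegral_ofReal]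
  · refine Integrable.of_integral_ne_zero ?_
    rw [h]
    have := Real.Gamma_pos_of_pos ha
    positivity
  · filter_upwards [ae_restrict_mem measurableSet_Ioi] with t ht
    have : (0 : ℝ) < t := ht
    positivity

theorem lintegral_exp_neg {r : ℝ} (hr : 0 < r) :
    ∫⁻ t in Set.Ioi (0 : ℝ), ENNReal.ofReal (Real.exp (-(r * t))) = ENNReal.ofReal (1 / r) := by
  simpa using lintegral_rpow_mul_exp_neg one_pos hr

theorem lintegral_mul_exp_neg {r : ℝ} (hr : 0 < r) :
    ∫⁻ t in Set.Ioi (0 : ℝ), ENNReal.ofReal (t * Real.exp (-(r * t))) =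
      ENNReal.ofReal ((1 / r) ^ 2) := by
  have h := lintegral_rpow_mul_exp_neg two_pos hr
  norm_num at h ⊢
  exact h

instance : IsProbabilityMeasure expLaw := by
  refine ⟨?_⟩
  rw [expLaw, withDensity_apply _ MeasurableSet.univ, Measure.restrict_univ]
  simpa using lintegral_exp_neg one_pos

theorem lintegral_expLaw {F : ℝ → ENNReal} (hF : Measurable F) :
    ∫⁻ t, F t ∂expLaw =
      ∫⁻ t in Set.Ioi (0 : ℝ), ENNReal.ofReal (Real.exp (-t)) * F t := by
  rw [expLaw, lintegral_withDensity_eq_lintegral_mul _ (by fun_prop) hF]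
  rfl

theorem ae_pos_expLaw : ∀ᵐ t ∂expLaw, 0 < t :=
  (withDensity_absolutelyContinuous _ _).ae_le (ae_restrict_mem measurableSet_Ioi)

theorem expLaw_Ici_le (x : ℝ) : expLaw (Set.Ici x) ≤ ENNReal.ofReal (Real.exp (-x)) := by
  rw [expLaw, withDensity_apply _ measurableSet_Ici, Measure.restrict_restrict measurableSet_Ici]
  refine (lintegral_mono_set Set.inter_subset_left).trans ?_
  rw [Measure.restrict_congr_set Ioi_ae_eq_Ici.symm,
    ← ofReal_integral_eq_lintegral_ofReal, integral_exp_neg_Ioi]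
  · have h := exp_neg_integrableOn_Ioi x one_pos
    simp only [neg_mul, one_mul] at h
    exact h
  · exact Filter.Eventually.of_forall fun t => (Real.exp_pos _).le

/-- The density is at most e^(-x) on an interval of length at most z. Keeping the factor e^(-x) lets
it merge with the tails of the other clocks. -/
theorem expLaw_Icc_le {x z : ℝ} (hx : 0 ≤ x) :
    expLaw (Set.Icc x z) ≤ ENNReal.ofReal (Real.exp (-x) * z) := by
  rw [expLaw, withDensity_apply _ measurableSet_Icc, Measure.restrict_restrict measurableSet_Icc]
  refine (lintegral_mono_set Set.inter_subset_left).trans ?_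
  refine (setLIntegral_mono (g := fun _ => ENNReal.ofReal (Real.exp (-x))) (by fun_prop)
    fun t ht => ENNReal.ofReal_le_ofReal (Real.exp_le_exp.2 (neg_le_neg ht.1))).trans ?_
  rw [setLIntegral_const, Real.volume_Icc, ENNReal.ofReal_mul (Real.exp_pos _).le]
  gcongr
  linarith

/-- Independent exponential clocks. -/
noncomputable abbrev clocks (n : ℕ) : Measure (Fin n → ℝ) := Measure.pi fun _ => expLaw

theorem ae_pos_clocks (n : ℕ) : ∀ᵐ x ∂clocks n, ∀ y, 0 < x y :=
  ae_all_iff.2 fun y =>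
    (Measure.quasiMeasurePreserving_eval (μ := fun _ : Fin n => expLaw) y).ae ae_pos_expLaw

/-- Fubini: given the clock of y, the conditions on the other clocks are independent. -/
theorem clocks_slice {n : ℕ} (y : Fin (n + 1)) (C : Fin n → ℝ → Set ℝ)
    (hC : MeasurableSet {q : ℝ × (Fin n → ℝ) | ∀ i, q.2 i ∈ C i q.1}) :
    clocks (n + 1) {x | ∀ i, x (y.succAbove i) ∈ C i (x y)} =
      ∫⁻ t in Set.Ioi (0 : ℝ), ENNReal.ofReal (Real.exp (-t)) * ∏ i, expLaw (C i t) := by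
  have hmp := measurePreserving_piFinSuccAbove (fun _ : Fin (n + 1) => expLaw) y
  have h1 : {x : Fin (n + 1) → ℝ | ∀ i, x (y.succAbove i) ∈ C i (x y)} =
      MeasurableEquiv.piFinSuccAbove (fun _ => ℝ) y ⁻¹'
        {q : ℝ × (Fin n → ℝ) | ∀ i, q.2 i ∈ C i q.1} := rfl
  have hslice : ∀ t : ℝ, (Measure.pi fun _ : Fin n => expLaw)
      (Prod.mk t ⁻¹' {q : ℝ × (Fin n → ℝ) | ∀ i, q.2 i ∈ C i q.1}) = ∏ i, expLaw (C i t) := by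
    intro t
    rw [← Measure.pi_pi]
    congr 1
    ext x
    simp
  rw [h1, hmp.measure_preimage hC.nullMeasurableSet, Measure.prod_apply hC, lintegral_expLaw]
  · simp only [hslice]
  · exact measurable_measure_prodMk_left hC

/-- The rates add up to 1 + ∑ q i / q y over i ≠ y, which is 1 / q y because q has total mass 1. -/
theorem exp_mul_prod_exp_eq {n : ℕ} {q : Fin (n + 1) → ℝ} (hq : ∑ y, q y = 1)
    {y : Fin (n + 1)} (hy : 0 < q y) (t : ℝ) :
    Real.exp (-t) * ∏ i : Fin n, Real.exp (-(t * (q (y.succAbove i) / q y))) =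
      Real.exp (-(1 / q y * t)) := by
  rw [← Real.exp_sum, ← Real.exp_add]
  congr 1
  rw [Fin.sum_univ_succAbove _ y] at hq
  rw [Finset.sum_neg_distrib, ← Finset.mul_sum, ← Finset.sum_div, eq_sub_of_add_eq' hq]
  field_simp
  ring

/-- Conditionally on the clock t of y, the survival probabilities multiply to leave the integral of
e^(-t/q y), which is q y. -/
theorem clocks_winner_le {n : ℕ} {q : Fin (n + 1) → ℝ} (hq : ∑ y, q y = 1)
    {y : Fin (n + 1)} (hy : 0 < q y) :
    clocks (n + 1) {x | ∀ i : Fin n, x y * (q (y.succAbove i) / q y) ≤ x (y.succAbove i)} ≤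
      ENNReal.ofReal (q y) := by
  have hC : MeasurableSet {p : ℝ × (Fin n → ℝ) | ∀ i : Fin n,
      p.2 i ∈ Set.Ici (p.1 * (q (y.succAbove i) / q y))} := by
    simp only [Set.mem_Ici, Set.ofPred_forall]
    exact MeasurableSet.iInter fun i => measurableSet_le (by fun_prop) (by fun_prop)
  refine (clocks_slice y (fun i t => Set.Ici (t * (q (y.succAbove i) / q y))) hC).trans_le ?_
  have hr : 0 < 1 / q y := by positivity
  have := lintegral_exp_neg hr
  rw [one_div_one_div] at this
  rw [← this]
  refine setLIntegral_mono (by fun_prop) fun t ht => ?_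
  have ht : 0 < t := ht
  rw [← exp_mul_prod_exp_eq hq hy, ENNReal.ofReal_mul (Real.exp_pos _).le,
    ENNReal.ofReal_prod_of_nonneg fun i _ => (Real.exp_pos _).le]
  gcongr with i
  exact expLaw_Ici_le _

/-- Confining clock j to an interval ending at t b costs an extra factor t b, and the integral of t
e^(-t/q y) is (q y)². -/
theorem clocks_winner_and_le_le {n : ℕ} {q : Fin (n + 1) → ℝ} (hq0 : ∀ y, 0 ≤ q y)
    (hq : ∑ y, q y = 1) {y : Fin (n + 1)} (hy : 0 < q y) (j : Fin n) {b : ℝ} (hb : 0 ≤ b) :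
    clocks (n + 1) {x | (∀ i : Fin n, x y * (q (y.succAbove i) / q y) ≤ x (y.succAbove i)) ∧
      x (y.succAbove j) ≤ x y * b} ≤ ENNReal.ofReal (b * q y ^ 2) := by
  have hC : MeasurableSet {p : ℝ × (Fin n → ℝ) | ∀ i : Fin n,
      p.2 i ∈ Set.Ici (p.1 * (q (y.succAbove i) / q y)) ∩ {x | i = j → x ≤ p.1 * b}} := by
    rw [Set.ofPred_forall]
    refine MeasurableSet.iInter fun i => MeasurableSet.inter
      (s₁ := {p : ℝ × (Fin n → ℝ) | p.1 * (q (y.succAbove i) / q y) ≤ p.2 i})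
      (s₂ := {p : ℝ × (Fin n → ℝ) | i = j → p.2 i ≤ p.1 * b})
      (measurableSet_le (by fun_prop) (by fun_prop)) ?_
    by_cases hij : i = j
    · simp only [hij, true_imp_iff]
      exact measurableSet_le (by fun_prop) (by fun_prop)
    · simp [hij]
  have hset : {x : Fin (n + 1) → ℝ | (∀ i : Fin n, x y * (q (y.succAbove i) / q y) ≤
      x (y.succAbove i)) ∧ x (y.succAbove j) ≤ x y * b} = {x | ∀ i : Fin n,
        x (y.succAbove i) ∈ Set.Ici (x y * (q (y.succAbove i) / q y)) ∩
          {u | i = j → u ≤ x y * b}} := by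
    ext x
    simp [forall_and]
  rw [hset]
  refine (clocks_slice y (fun i t => Set.Ici (t * (q (y.succAbove i) / q y)) ∩
    {x | i = j → x ≤ t * b}) hC).trans_le ?_
  have hr : 0 < 1 / q y := by positivity
  have := lintegral_mul_exp_neg hr
  rw [one_div_one_div] at this
  rw [ENNReal.ofReal_mul hb, ← this, ← lintegral_const_mul _ (by fun_prop)]
  refine setLIntegral_mono (by fun_prop) fun t ht => ?_
  have ht : 0 < t := ht
  have hc : ∀ i : Fin n, 0 ≤ t * (q (y.succAbove i) / q y) := fun i =>
    mul_nonneg ht.le (div_nonneg (hq0 _) hy.le)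
  have hprod : ∏ i : Fin n, expLaw (Set.Ici (t * (q (y.succAbove i) / q y)) ∩
      {x | i = j → x ≤ t * b}) ≤
      ∏ i : Fin n, ENNReal.ofReal (Real.exp (-(t * (q (y.succAbove i) / q y))) *
        if i = j then t * b else 1) := by
    refine Finset.prod_le_prod' fun i _ => ?_
    split_ifs with hij
    · refine le_trans (measure_mono fun x hx => ?_) (expLaw_Icc_le (hc i))
      exact ⟨hx.1, hx.2 hij⟩
    · rw [mul_one]
      exact (measure_mono Set.inter_subset_left).trans (expLaw_Ici_le _)
  refine (mul_le_mul_right hprod _).trans (le_of_eq ?_)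
  rw [← ENNReal.ofReal_prod_of_nonneg fun i _ =>
      mul_nonneg (Real.exp_pos _).le (by split_ifs <;> positivity),
    Finset.prod_mul_distrib, Finset.prod_ite_eq' univ j, if_pos (mem_univ j),
    ← ENNReal.ofReal_mul (Real.exp_pos _).le, ← ENNReal.ofReal_mul hb, ← mul_assoc,
    exp_mul_prod_exp_eq hq hy]
  congr 1
  ring

/-- The score of `y` when its clock shows `x y` and its weight is `q y`; ties are broken by the
order. -/
noncomputable def score {n : ℕ} (q x : Fin n → ℝ) (y : Fin n) : ℝ ×ₗ Fin n := toLex (q y / x y, y)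

/-- Makes the winner unique for every clock reading, so that ties need no almost-sure argument. -/
theorem score_injective {n : ℕ} (q x : Fin n → ℝ) : Function.Injective (score q x) := by
  intro y y' h
  have := congrArg (fun u => (ofLex u).2) h
  simpa [score] using this

theorem measurableSet_score_le {n : ℕ} (q : Fin n → ℝ) (y y' : Fin n) :
    MeasurableSet {x | score q x y ≤ score q x y'} := by
  simp only [score, Prod.Lex.toLex_le_toLex, Set.ofPred_or, Set.ofPred_and]
  exact (measurableSet_lt (by fun_prop) (by fun_prop)).union
    ((measurableSet_eq_fun (by fun_prop) (by fun_prop)).inter (MeasurableSet.const _))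

theorem div_le_div_of_score_le {n : ℕ} {q x : Fin n → ℝ} {y y' : Fin n}
    (h : score q x y ≤ score q x y') : q y / x y ≤ q y' / x y' := by
  rw [score, score, Prod.Lex.toLex_le_toLex] at h
  rcases h with h | h
  · exact h.le
  · exact h.1.le

theorem exists_score_max {n : ℕ} (q x : Fin (n + 1) → ℝ) :
    ∃ y, ∀ y', score q x y' ≤ score q x y := by
  obtain ⟨y, -, hy⟩ := Finset.exists_max_image univ (score q x) univ_nonempty
  exact ⟨y, fun y' => hy y' (mem_univ _)⟩

/-- The winner of the race with weights `q`. -/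
noncomputable def winner {n : ℕ} (q x : Fin (n + 1) → ℝ) : Fin (n + 1) :=
  (exists_score_max q x).choose

theorem winner_eq_iff {n : ℕ} {q x : Fin (n + 1) → ℝ} {y : Fin (n + 1)} :
    winner q x = y ↔ ∀ y', score q x y' ≤ score q x y := by
  have hw := (exists_score_max q x).choose_spec
  constructor
  · rintro rfl
    exact hw
  · intro h
    exact score_injective q x (le_antisymm (h _) (hw y))

theorem measurable_winner {n : ℕ} (q : Fin (n + 1) → ℝ) : Measurable (winner q) := by
  refine measurable_to_countable' fun y => ?_
  have : winner q ⁻¹' {y} = ⋂ y', {x | score q x y' ≤ score q x y} := by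
    ext x
    simp [winner_eq_iff]
  rw [this]
  exact MeasurableSet.iInter fun y' => measurableSet_score_le q y' y

theorem winner_pos {n : ℕ} {q x : Fin (n + 1) → ℝ} (hq0 : ∀ y, 0 ≤ q y) (hq : ∑ y, q y = 1)
    (hx : ∀ y, 0 < x y) : 0 < q (winner q x) := by
  obtain ⟨y, -, hy⟩ : ∃ y ∈ univ, q y ≠ 0 := by
    by_contra! h
    rw [Finset.sum_eq_zero h] at hq
    exact zero_ne_one hq
  have hy : 0 < q y := lt_of_le_of_ne (hq0 y) hy.symm
  have h1 := div_le_div_of_score_le (winner_eq_iff.1 (rfl : winner q x = winner q x) y)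
  have h2 : 0 < q (winner q x) / x (winner q x) := (div_pos hy (hx y)).trans_le h1
  exact (div_pos_iff_of_pos_right (hx _)).1 h2

theorem mul_le_of_winner_eq {n : ℕ} {q x : Fin (n + 1) → ℝ} (hx : ∀ y, 0 < x y)
    {y : Fin (n + 1)} (hy : 0 < q y) (h : winner q x = y) (y' : Fin (n + 1)) :
    x y * (q y' / q y) ≤ x y' := by
  have h1 := div_le_div_of_score_le (winner_eq_iff.1 h y')
  rw [div_le_div_iff₀ (hx _) (hx _)] at h1
  rw [← mul_div_assoc, div_le_iff₀ hy]
  linarith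

theorem clocks_real_winner_le {n : ℕ} {q : Fin (n + 1) → ℝ} (hq0 : ∀ y, 0 ≤ q y)
    (hq : ∑ y, q y = 1) (y : Fin (n + 1)) :
    (clocks (n + 1)).real {x | winner q x = y} ≤ q y := by
  rcases eq_or_lt_of_le (hq0 y) with hy | hy
  · rw [← hy, measureReal_def, measure_eq_zero_iff_ae_notMem.2, ENNReal.toReal_zero]
    filter_upwards [ae_pos_clocks (n + 1)] with x hx h
    have := winner_pos hq0 hq hx
    rw [show winner q x = y from h] at this
    exact this.ne hy
  · refine ENNReal.toReal_le_of_le_ofReal hy.le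
      ((measure_mono_ae ?_).trans (clocks_winner_le hq hy))
    filter_upwards [ae_pos_clocks (n + 1)] with x hx h i
    exact mul_le_of_winner_eq hx hy h _

/-- The upper bounds for the individual letters and the winning probabilities both sum to 1, so each
bound is an equality. -/
theorem clocks_real_winner {n : ℕ} {q : Fin (n + 1) → ℝ} (hq0 : ∀ y, 0 ≤ q y)
    (hq : ∑ y, q y = 1) (y : Fin (n + 1)) :
    (clocks (n + 1)).real {x | winner q x = y} = q y := by
  have h1 : ∑ y, (clocks (n + 1)).real {x | winner q x = y} = 1 := by
    refine (sum_measureReal_preimage_singleton (μ := clocks (n + 1)) univ (f := winner q)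
      fun y _ => measurable_winner q (measurableSet_singleton y)).trans ?_
    simp
  exact (Finset.sum_eq_sum_iff_of_le fun y _ => clocks_real_winner_le hq0 hq y).1
    (h1.trans hq.symm) y (mem_univ y)

/-- That y' is not behind y in the race weighted by P means x y' ≤ x y (P y' / P y), so the previous
estimate applies with b = P y' / P y. -/
theorem clocks_real_winner_and_score_le {n : ℕ} {q P : Fin (n + 1) → ℝ} (hq0 : ∀ y, 0 ≤ q y)
    (hq : ∑ y, q y = 1) (hP0 : ∀ y, 0 ≤ P y) {y y' : Fin (n + 1)} (hy : 0 < q y) (hPy : 0 < P y)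
    (hyy' : y' ≠ y) :
    (clocks (n + 1)).real {x | winner q x = y ∧ score P x y ≤ score P x y'} ≤
      P y' / P y * q y ^ 2 := by
  obtain ⟨j, rfl⟩ := Fin.exists_succAbove_eq hyy'
  have hb : 0 ≤ P (y.succAbove j) / P y := div_nonneg (hP0 _) hPy.le
  refine ENNReal.toReal_le_of_le_ofReal (by positivity)
    ((measure_mono_ae ?_).trans (clocks_winner_and_le_le hq0 hq hy j hb))
  filter_upwards [ae_pos_clocks (n + 1)] with x hx h
  refine ⟨fun i => mul_le_of_winner_eq hx hy h.1 _, ?_⟩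
  have h1 := div_le_div_of_score_le h.2
  rw [div_le_div_iff₀ (hx _) (hx _)] at h1
  rw [← mul_div_assoc, le_div_iff₀ hPy]
  linarith

open Classical in
/-- Letters drawn from all the laws `Q a` by one race, together with the ranks of the letters in the
race with weights `P`. -/
theorem exists_race.{u} {A : Type u} [Fintype A] {n : ℕ} {P : Fin (n + 1) → ℝ}
    {Q : A → Fin (n + 1) → ℝ} (hP0 : ∀ y, 0 ≤ P y) (hP : ∑ y, P y = 1)
    (hQ0 : ∀ a y, 0 ≤ Q a y) (hQ : ∀ a, ∑ y, Q a y = 1) (hQP : ∀ a y, 0 < Q a y → 0 < P y) :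
    ∃ (F : Type u) (_ : Fintype F) (l : F → ℝ) (z : F → A → Fin (n + 1))
      (R : F → Fin (n + 1) → ℕ), (∀ x, 0 ≤ l x) ∧ ∑ x, l x = 1 ∧
      (∀ x, l x ≠ 0 → Function.Injective (R x) ∧ ∀ y, 1 ≤ R x y) ∧
      (∀ a y, ∑ x with z x a = y, l x = Q a y) ∧
      (∀ a y, 0 < Q a y → ∑ x with z x a = y, l x * R x y ≤ Q a y * (1 + Q a y / P y)) := by
  let μ := clocks (n + 1)
  -- A finite statistic of the clocks that keeps only what is needed, namely all the winners and the
  -- order of the P-scores; its law is the finite probability space `F`. The rank counts the letters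
  -- with at least as large a score, so the leader has rank 1.
  let X : (Fin (n + 1) → ℝ) → (A → Fin (n + 1)) × (Fin (n + 1) → Fin (n + 1) → Prop) :=
    fun x => (fun a => winner (Q a) x, fun y y' => score P x y ≤ score P x y')
  have hX : Measurable X := by
    refine Measurable.prodMk (measurable_pi_lambda _ fun a => measurable_winner _)
      (measurable_pi_lambda _ fun y => measurable_pi_lambda _ fun y' => ?_)
    exact measurableSet_setOfPred.1 (measurableSet_score_le P y y')
  have hsum : ∀ (p : (A → Fin (n + 1)) × (Fin (n + 1) → Fin (n + 1) → Prop) → Prop)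
      [DecidablePred p], ∑ x with p x, μ.real (X ⁻¹' {x}) = μ.real {ω | p (X ω)} := by
    intro p _
    rw [sum_measureReal_preimage_singleton _ fun x _ => hX (measurableSet_singleton x)]
    congr 1
    ext ω
    simp
  refine ⟨(A → Fin (n + 1)) × (Fin (n + 1) → Fin (n + 1) → Prop), inferInstance,
    fun x => μ.real (X ⁻¹' ({x} : Set _)), fun x => x.1,
    fun x y => #{y' | x.2 y y'}, fun x => measureReal_nonneg, ?_, ?_, ?_, ?_⟩
  · have := hsum fun _ => True
    simpa using this
  -- A relation of positive probability comes from actual clocks, hence is a total order, and its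
  -- ranks are distinct.
  · intro x hx
    obtain ⟨ω, hω⟩ : (X ⁻¹' {x}).Nonempty := by
      rw [Set.nonempty_iff_ne_empty]
      intro h
      dsimp only at hx
      rw [h] at hx
      simp at hx
    have hω : X ω = x := hω
    subst hω
    constructor
    · have key : ∀ y y', score P ω y < score P ω y' →
          #{u | (X ω).2 y' u} < #{u | (X ω).2 y u} := by
        intro y y' h
        refine Finset.card_lt_card ⟨fun u hu => ?_, fun hs => ?_⟩
        · exact Finset.mem_filter.2
            ⟨mem_univ u, h.le.trans (Finset.mem_filter.1 hu).2⟩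
        · have hy : y ∈ ({u | (X ω).2 y u} : Finset (Fin (n + 1))) :=
            Finset.mem_filter.2 ⟨mem_univ y, le_refl (score P ω y)⟩
          exact absurd (Finset.mem_filter.1 (hs hy)).2 (not_le.2 h)
      intro y y' h
      rcases lt_trichotomy (score P ω y) (score P ω y') with h1 | h1 | h1
      · exact absurd (by convert h) (key y y' h1).ne'
      · exact score_injective _ _ h1
      · exact absurd (by convert h) (key y' y h1).ne
    · intro y
      refine Finset.card_pos.2 ⟨y, ?_⟩
      simp [X]
  · intro a y
    refine (hsum fun x => x.1 a = y).trans ?_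
    exact clocks_real_winner (hQ0 a) (hQ a) y
  · intro a y hy
    -- The rank of y is a sum of indicators over y'. The index y' = y will contribute at most Q a y,
    -- the others together at most Q a y ^ 2 / P y.
    have h1 : ∑ x : (A → Fin (n + 1)) × (Fin (n + 1) → Fin (n + 1) → Prop) with x.1 a = y,
        μ.real (X ⁻¹' {x}) * (#{y' | x.2 y y'} : ℕ) =
        ∑ y', μ.real {ω | winner (Q a) ω = y ∧ score P ω y ≤ score P ω y'} := by
      have : ∀ y', μ.real {ω | winner (Q a) ω = y ∧ score P ω y ≤ score P ω y'} =
          ∑ x : (A → Fin (n + 1)) × (Fin (n + 1) → Fin (n + 1) → Prop) with x.1 a = y,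
            if x.2 y y' then μ.real (X ⁻¹' {x}) else 0 := by
        intro y'
        rw [← Finset.sum_filter, Finset.filter_filter]
        exact (hsum fun x => x.1 a = y ∧ x.2 y y').symm
      simp only [this]
      rw [Finset.sum_comm]
      refine Finset.sum_congr rfl fun x _ => ?_
      rw [← Finset.sum_filter, Finset.sum_const, nsmul_eq_mul, mul_comm]
    refine h1.trans_le ?_
    have hPy := hQP a y hy
    rw [← Finset.add_sum_erase univ _ (mem_univ y)]
    have h2 : μ.real {ω | winner (Q a) ω = y ∧ score P ω y ≤ score P ω y} ≤ Q a y := by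
      simp only [le_refl, and_true]
      exact clocks_real_winner_le (hQ0 a) (hQ a) y
    have h3 : ∑ y' ∈ univ.erase y,
        μ.real {ω | winner (Q a) ω = y ∧ score P ω y ≤ score P ω y'} ≤
        Q a y ^ 2 / P y := by
      calc _ ≤ ∑ y' ∈ univ.erase y, P y' / P y * Q a y ^ 2 :=
            Finset.sum_le_sum fun y' hy' => clocks_real_winner_and_score_le (hQ0 a) (hQ a) hP0 hy
              hPy (Finset.ne_of_mem_erase hy')
        _ ≤ ∑ y', P y' / P y * Q a y ^ 2 :=
            Finset.sum_le_sum_of_subset_of_nonneg (Finset.erase_subset _ _) fun y' _ _ =>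
              mul_nonneg (div_nonneg (hP0 _) hPy.le) (sq_nonneg _)
        _ = _ := by
            rw [← Finset.sum_mul, ← Finset.sum_div, hP]
            ring
    calc _ ≤ Q a y + Q a y ^ 2 / P y := add_le_add h2 h3
      _ = _ := by ring

end SemPriv

namespace SemPriv

open Finset

variable {A B : Type*} [Fintype A] [Fintype B]

/-! ### Couplings of the conditional laws -/

open Classical in
/-- A law on functions `A → B` whose evaluation at `a` has the conditional law that `w` gives to the
column index in row `a`. -/
structure IsCoupling (w : A → B → ℝ) (M : (A → B) → ℝ) : Prop where
  nonneg : ∀ z, 0 ≤ M z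
  sum_eq_one : ∑ z, M z = 1
  rowSum_mul : ∀ a b, (∑ b', w a b') * ∑ z with z a = b, M z = w a b

open Classical in
/-- The expected entropy of the image of the row marginal of `w` under a random function. -/
noncomputable def couplingCost (w : A → B → ℝ) (M : (A → B) → ℝ) : ℝ :=
  ∑ z, M z * weightEntropy fun b => ∑ a with z a = b, ∑ b', w a b'

/-! ### Gibbs' inequality, Zipf coding and Jensen-type bounds -/

theorem weightEntropy_le {m v : B → ℝ} (hm0 : ∀ b, 0 ≤ m b) (hm : ∑ b, m b = 1)
    (hv0 : ∀ b, 0 < v b) (hv : ∑ b, v b ≤ 1) :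
    weightEntropy m ≤ ∑ b, m b * Real.logb 2 (1 / v b) := by
  have hl : 0 < Real.log 2 := Real.log_pos one_lt_two
  have key : ∀ b, m b * Real.logb 2 (1 / m b) ≤
      m b * Real.logb 2 (1 / v b) + (v b - m b) / Real.log 2 := by
    intro b
    rcases eq_or_lt_of_le (hm0 b) with h | h
    · rw [← h]
      have := div_nonneg (hv0 b).le hl.le
      simpa using this
    have hv := hv0 b
    have h1 : Real.logb 2 (1 / m b) = Real.logb 2 (1 / v b) + Real.logb 2 (v b / m b) := by
      rw [← Real.logb_mul (by positivity) (by positivity)]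
      congr 1
      field_simp
    have h2 := mul_le_mul_of_nonneg_left
      (logb_two_le_sub_one_div (x := v b / m b) (by positivity)) h.le
    have h3 : m b * ((v b / m b - 1) / Real.log 2) = (v b - m b) / Real.log 2 := by
      field_simp
    rw [h1]
    linarith
  refine (Finset.sum_le_sum fun b _ => key b).trans ?_
  rw [Finset.sum_add_distrib, ← Finset.sum_div, Finset.sum_sub_distrib, hm]
  have : (∑ b, v b - 1) / Real.log 2 ≤ 0 := div_nonpos_of_nonpos_of_nonneg (by linarith) hl.le
  linarith

/-- The comparison of m^(-1-d) with the integral of x^(-1-d) over [m-1, m], in a form that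
telescopes. It reduces to (1 - 1/m)^(-d) ≥ 1 + d/m. -/
theorem rpow_neg_add_le {d m : ℝ} (hd : 0 < d) (hm : 1 < m) :
    m ^ (-(1 + d)) ≤ ((m - 1) ^ (-d) - m ^ (-d)) / d := by
  have hm0 : 0 < m := by linarith
  have hm1 : 0 < m - 1 := by linarith
  have h1 : 1 + d / m ≤ ((m - 1) / m) ^ (-d) := by
    rw [Real.rpow_def_of_pos (by positivity)]
    have h2 := Real.log_le_sub_one_of_pos (x := (m - 1) / m) (by positivity)
    have h3 : (m - 1) / m - 1 = -(1 / m) := by field_simp; ring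
    have h4 := Real.add_one_le_exp (Real.log ((m - 1) / m) * -d)
    have h5 : d / m = d * (1 / m) := by ring
    nlinarith
  have h6 : (m - 1) ^ (-d) = m ^ (-d) * ((m - 1) / m) ^ (-d) := by
    rw [← Real.mul_rpow hm0.le (by positivity)]
    congr 1
    field_simp
  have h7 : m ^ (-(1 + d)) = m ^ (-d) / m := by
    rw [neg_add_rev, Real.rpow_add hm0, Real.rpow_neg_one]
    rfl
  have h8 : 0 < m ^ (-d) := by positivity
  rw [le_div_iff₀ hd, h6, h7]
  have := mul_le_mul_of_nonneg_left h1 h8.le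
  have h9 : m ^ (-d) / m * d = m ^ (-d) * (d / m) := by ring
  linarith

theorem sum_range_rpow_neg_le {d : ℝ} (hd : 0 < d) (N : ℕ) :
    ∑ k ∈ range (N + 1), ((k + 1 : ℕ) : ℝ) ^ (-(1 + d)) ≤
      1 + (1 - ((N + 1 : ℕ) : ℝ) ^ (-d)) / d := by
  induction N with
  | zero => simp
  | succ N ih =>
    rw [Finset.sum_range_succ]
    have h := rpow_neg_add_le (m := ((N + 1 + 1 : ℕ) : ℝ)) hd (by push_cast; linarith)
    have h1 : ((N + 1 + 1 : ℕ) : ℝ) - 1 = ((N + 1 : ℕ) : ℝ) := by push_cast; ring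
    rw [h1] at h
    refine (add_le_add ih h).trans (le_of_eq ?_)
    ring

theorem sum_rpow_neg_le_of_injective {d : ℝ} (hd : 0 < d) {R : B → ℕ} (hR : R.Injective)
    (hR1 : ∀ b, 1 ≤ R b) : ∑ b, (R b : ℝ) ^ (-(1 + d)) ≤ 1 + 1 / d := by
  classical
  obtain ⟨N, hN⟩ : ∃ N, ∀ b, R b ≤ N + 1 := by
    refine ⟨∑ b, R b, fun b => ?_⟩
    have := Finset.single_le_sum (f := R) (fun _ _ => Nat.zero_le _) (mem_univ b)
    omega
  have h1 : ∑ b, (R b : ℝ) ^ (-(1 + d)) =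
      ∑ k ∈ univ.image (fun b => R b - 1), ((k + 1 : ℕ) : ℝ) ^ (-(1 + d)) := by
    rw [Finset.sum_image]
    · exact Finset.sum_congr rfl fun b _ => by rw [Nat.sub_add_cancel (hR1 b)]
    · intro b _ b' _ h
      have h2 := hR1 b
      have h3 := hR1 b'
      have h4 : R b - 1 = R b' - 1 := h
      exact hR (by omega)
  rw [h1]
  refine (Finset.sum_le_sum_of_subset_of_nonneg (t := range (N + 1)) ?_
    fun _ _ _ => by positivity).trans ((sum_range_rpow_neg_le hd N).trans ?_)
  · intro k hk
    obtain ⟨b, -, rfl⟩ := Finset.mem_image.1 hk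
    have := hN b
    have := hR1 b
    exact Finset.mem_range.2 (by omega)
  · have : 0 ≤ ((N + 1 : ℕ) : ℝ) ^ (-d) := by positivity
    gcongr
    linarith

/-- Zipf coding: an injective integer label with expected logarithm at most `L` bounds the entropy. -/
theorem weightEntropy_le_zipf {m : B → ℝ} (hm0 : ∀ b, 0 ≤ m b) (hm : ∑ b, m b = 1)
    {R : B → ℕ} (hR : R.Injective) (hR1 : ∀ b, 1 ≤ R b) {L : ℝ} (hL : 0 < L) :
    weightEntropy m ≤ (1 + 1 / L) * (∑ b, m b * Real.logb 2 (R b)) + Real.logb 2 (L + 1) := by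
  have hd : 0 < 1 / L := by positivity
  have hR0 : ∀ b, (0 : ℝ) < R b := fun b => Nat.cast_pos.2 (hR1 b)
  -- The comparison law in Gibbs' inequality. With exponent 1 + 1/L the sum of the powers is at most
  -- 1 + L, whence the normalization.
  have hv0 : ∀ b, 0 < (R b : ℝ) ^ (-(1 + 1 / L)) / (L + 1) := fun b =>
    div_pos (Real.rpow_pos_of_pos (hR0 b) _) (by linarith)
  have hv : ∑ b, (R b : ℝ) ^ (-(1 + 1 / L)) / (L + 1) ≤ 1 := by
    rw [← Finset.sum_div, div_le_one (by linarith)]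
    have := sum_rpow_neg_le_of_injective hd hR hR1
    rw [one_div_one_div] at this
    linarith
  refine (weightEntropy_le hm0 hm hv0 hv).trans (le_of_eq ?_)
  have : ∀ b, m b * Real.logb 2 (1 / ((R b : ℝ) ^ (-(1 + 1 / L)) / (L + 1))) =
      (1 + 1 / L) * (m b * Real.logb 2 (R b)) + m b * Real.logb 2 (L + 1) := by
    intro b
    rw [one_div_div, Real.logb_div (by linarith) (Real.rpow_pos_of_pos (hR0 b) _).ne',
      Real.logb_rpow_eq_mul_logb_of_pos (hR0 b)]
    ring
  simp only [this]
  rw [Finset.sum_add_distrib, ← Finset.mul_sum, ← Finset.sum_mul, hm, one_mul]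

/-- Jensen's inequality for the logarithm under a measure of total mass q, stated without dividing
by q. -/
theorem sum_mul_logb_le {ι : Type*} (s : Finset ι) {l k : ι → ℝ} (hl : ∀ x ∈ s, 0 ≤ l x)
    (hk : ∀ x ∈ s, l x ≠ 0 → 0 < k x) {q c : ℝ} (hc : 0 < c) (hq : ∑ x ∈ s, l x = q)
    (hlk : ∑ x ∈ s, l x * k x ≤ q * c) :
    ∑ x ∈ s, l x * Real.logb 2 (k x) ≤ q * Real.logb 2 c := by
  have hl2 : 0 < Real.log 2 := Real.log_pos one_lt_two
  have key : ∀ x ∈ s, l x * Real.logb 2 (k x) ≤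
      l x * Real.logb 2 c + (l x * k x / c - l x) / Real.log 2 := by
    intro x hx
    rcases eq_or_lt_of_le (hl x hx) with h | h
    · simp [← h]
    have hkx := hk x hx h.ne'
    have h1 : Real.logb 2 (k x) = Real.logb 2 c + Real.logb 2 (k x / c) := by
      rw [← Real.logb_mul (by positivity) (by positivity)]
      congr 1
      field_simp
    have h2 := mul_le_mul_of_nonneg_left
      (logb_two_le_sub_one_div (x := k x / c) (by positivity)) h.le
    have h3 : l x * ((k x / c - 1) / Real.log 2) = (l x * k x / c - l x) / Real.log 2 := by ring
    rw [h1]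
    linarith
  refine (Finset.sum_le_sum key).trans ?_
  rw [Finset.sum_add_distrib, ← Finset.sum_mul, hq, ← Finset.sum_div, Finset.sum_sub_distrib,
    ← Finset.sum_div, hq]
  have : ((∑ x ∈ s, l x * k x) / c - q) / Real.log 2 ≤ 0 :=
    div_nonpos_of_nonpos_of_nonneg (by rw [sub_nonpos, div_le_iff₀ hc]; exact hlk) hl2.le
  linarith

/-- With r = q/P, log(1 + r) = log r + 1 + log((1 + 1/r)/2), and the argument of the last logarithm
has q-mean at most 1. The price of the added 1 is thus one bit. -/
theorem sum_mul_logb_one_add_le {P q : B → ℝ} (hP : ∑ b, P b = 1) (hP0 : ∀ b, 0 ≤ P b)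
    (hq0 : ∀ b, 0 ≤ q b) (hq : ∑ b, q b = 1) (hqP : ∀ b, 0 < q b → 0 < P b) :
    ∑ b, q b * Real.logb 2 (1 + q b / P b) ≤ ∑ b, q b * Real.logb 2 (q b / P b) + 1 := by
  have hl2 : 0 < Real.log 2 := Real.log_pos one_lt_two
  have key : ∀ b, q b * Real.logb 2 (1 + q b / P b) ≤
      q b * Real.logb 2 (q b / P b) + q b + (P b - q b) / (2 * Real.log 2) := by
    intro b
    rcases eq_or_lt_of_le (hq0 b) with h | h
    · simp only [← h, zero_mul, zero_add, sub_zero]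
      exact div_nonneg (hP0 b) (by positivity)
    have hPb := hqP b h
    have h1 : Real.logb 2 (1 + q b / P b) =
        Real.logb 2 (q b / P b) + Real.logb 2 2 + Real.logb 2 ((1 + P b / q b) / 2) := by
      rw [← Real.logb_mul (by positivity) (by positivity),
        ← Real.logb_mul (by positivity) (by positivity)]
      congr 1
      field_simp
      ring
    have h2 := mul_le_mul_of_nonneg_left
      (logb_two_le_sub_one_div (x := (1 + P b / q b) / 2) (by positivity)) h.le
    have h3 : q b * (((1 + P b / q b) / 2 - 1) / Real.log 2) =
        (P b - q b) / (2 * Real.log 2) := by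
      field_simp
      ring
    rw [h1, Real.logb_self_eq_one one_lt_two]
    linarith
  refine (Finset.sum_le_sum fun b _ => key b).trans (le_of_eq ?_)
  rw [Finset.sum_add_distrib, Finset.sum_add_distrib, hq, ← Finset.sum_div,
    Finset.sum_sub_distrib, hP, hq]
  simp

theorem weightInfo_nonneg {w : A → B → ℝ} (hw : ∀ a b, 0 ≤ w a b) (hw1 : ∑ a, ∑ b, w a b = 1) :
    0 ≤ weightInfo w := by
  have hl2 : 0 < Real.log 2 := Real.log_pos one_lt_two
  have key : ∀ a b, (w a b - (∑ b', w a b') * ∑ a', w a' b) / Real.log 2 ≤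
      w a b * Real.logb 2 (w a b / ((∑ b', w a b') * ∑ a', w a' b)) := by
    intro a b
    have hA0 : 0 ≤ ∑ b', w a b' := Finset.sum_nonneg fun b' _ => hw a b'
    have hB0 : 0 ≤ ∑ a', w a' b := Finset.sum_nonneg fun a' _ => hw a' b
    rcases eq_or_lt_of_le (hw a b) with h | h
    · rw [← h, zero_mul, zero_sub]
      exact div_nonpos_of_nonpos_of_nonneg (neg_nonpos.2 (mul_nonneg hA0 hB0)) hl2.le
    have hA := h.trans_le (le_rowSum hw a b)
    have hB := h.trans_le (le_colSum hw a b)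
    have h2 := mul_le_mul_of_nonneg_left (logb_two_le_sub_one_div
      (x := ((∑ b', w a b') * ∑ a', w a' b) / w a b) (by positivity)) h.le
    have h3 : Real.logb 2 (w a b / ((∑ b', w a b') * ∑ a', w a' b)) =
        -Real.logb 2 (((∑ b', w a b') * ∑ a', w a' b) / w a b) := by
      rw [← Real.logb_inv, inv_div]
    have h4 : w a b * ((((∑ b', w a b') * ∑ a', w a' b) / w a b - 1) / Real.log 2) =
        -((w a b - (∑ b', w a b') * ∑ a', w a' b) / Real.log 2) := by
      field_simp
      ring
    rw [h3]
    linarith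
  refine le_trans (le_of_eq ?_) (Finset.sum_le_sum fun a _ => Finset.sum_le_sum fun b _ => key a b)
  have h5 : ∑ a, ∑ b, (∑ b', w a b') * ∑ a', w a' b = 1 := by
    rw [← Finset.sum_mul_sum, hw1, Finset.sum_comm, hw1, one_mul]
  simp only [← Finset.sum_div, Finset.sum_sub_distrib]
  rw [h5, hw1]
  simp

theorem sum_fiber_eq_one {m : A → ℝ} (hm : ∑ a, m a = 1) [DecidableEq B] (z : A → B) :
    ∑ b, ∑ a with z a = b, m a = 1 := by
  rw [Finset.sum_fiberwise, hm]

theorem exists_conditional {w : A → B → ℝ} (hw : ∀ a b, 0 ≤ w a b) (hw1 : ∑ a, ∑ b, w a b = 1) :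
    ∃ Q : A → B → ℝ, (∀ a b, 0 ≤ Q a b) ∧ (∀ a, ∑ b, Q a b = 1) ∧
      (∀ a b, (∑ b', w a b') * Q a b = w a b) ∧ ∀ a b, 0 < Q a b → 0 < ∑ a', w a' b := by
  classical
  -- A row of mass zero receives the column marginal, so that every conditional law is absolutely
  -- continuous with respect to it.
  refine ⟨fun a b => if ∑ b', w a b' = 0 then ∑ a', w a' b else w a b / ∑ b', w a b', ?_, ?_, ?_,
    ?_⟩
  · intro a b
    have hA0 : 0 ≤ ∑ b', w a b' := Finset.sum_nonneg fun b' _ => hw a b'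
    have hB0 : 0 ≤ ∑ a', w a' b := Finset.sum_nonneg fun a' _ => hw a' b
    dsimp only
    split_ifs
    · exact hB0
    · exact div_nonneg (hw a b) hA0
  · intro a
    dsimp only
    split_ifs with h
    · rw [Finset.sum_comm, hw1]
    · rw [← Finset.sum_div, div_self h]
  · intro a b
    dsimp only
    split_ifs with h
    · rw [h, zero_mul]
      exact ((Finset.sum_eq_zero_iff_of_nonneg fun b _ => hw a b).1 h b (mem_univ b)).symm
    · rw [mul_div_cancel₀ _ h]
  · intro a b
    dsimp only
    split_ifs with h
    · exact id
    · intro hpos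
      refine lt_of_lt_of_le (lt_of_le_of_ne (hw a b) fun h0 => ?_) (le_colSum hw a b)
      rw [← h0, zero_div] at hpos
      exact lt_irrefl _ hpos

/-- The strong functional representation lemma, in the form of a bound for couplings. -/
theorem exists_coupling_cost_le {n : ℕ} {w : A → Fin (n + 1) → ℝ} (hw : ∀ a b, 0 ≤ w a b)
    (hw1 : ∑ a, ∑ b, w a b = 1) :
    ∃ M, IsCoupling w M ∧
      couplingCost w M ≤ weightInfo w + Real.logb 2 (weightInfo w + 1) + 4 := by
  classical
  obtain ⟨Q, hQ0, hQ1, hwQ, hQP⟩ := exists_conditional hw hw1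
  set P : Fin (n + 1) → ℝ := fun b => ∑ a, w a b with hPdef
  have hP0 : ∀ b, 0 ≤ P b := fun b => Finset.sum_nonneg fun a _ => hw a b
  have hP1 : ∑ b, P b = 1 := by rw [← hw1, Finset.sum_comm]
  set m : A → ℝ := fun a => ∑ b, w a b with hmdef
  have hm0 : ∀ a, 0 ≤ m a := fun a => Finset.sum_nonneg fun b _ => hw a b
  obtain ⟨F, _, l, z, R, hl0, hl1, hR, hlQ, hlR⟩ := exists_race hP0 hP1 hQ0 hQ1 hQP
  set I := weightInfo w with hI
  have hI0 : 0 ≤ I := weightInfo_nonneg hw hw1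
  refine ⟨fun y => ∑ x with z x = y, l x,
    ⟨fun y => Finset.sum_nonneg fun x _ => hl0 x, ?_, ?_⟩, ?_⟩
  · rw [Finset.sum_fiberwise, hl1]
  · intro a b
    rw [← hwQ a b, ← hlQ a b]
    congr 1
    rw [Finset.sum_filter, Finset.sum_filter]
    refine (Finset.sum_congr rfl fun y _ => ?_).trans (Finset.sum_fiberwise univ z _)
    split_ifs with h
    · refine Finset.sum_congr (by congr) fun x hx => ?_
      rw [(Finset.mem_filter.1 hx).2, if_pos h]
    · refine (Finset.sum_eq_zero fun x hx => ?_).symm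
      rw [(Finset.mem_filter.1 hx).2, if_neg h]
  · have hcost : couplingCost w (fun y => ∑ x with z x = y, l x) =
        ∑ x, l x * weightEntropy fun b => ∑ a with z x a = b, m a := by
      unfold couplingCost
      refine (Finset.sum_congr rfl fun y _ => ?_).trans (Finset.sum_fiberwise univ z _)
      rw [Finset.sum_mul]
      refine Finset.sum_congr (by congr) fun x hx => ?_
      rw [(Finset.mem_filter.1 hx).2]
      congr! 2
      funext b
      exact Finset.sum_congr (by congr!) fun _ _ => rfl
    -- Zipf coding for fixed clocks, the label of b being its rank. The parameter is I + 1 because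
    -- that will bound the expected log rank.
    have hzipf : ∀ x, l x * (weightEntropy fun b => ∑ a with z x a = b, m a) ≤
        l x * ((1 + 1 / (I + 1)) * (∑ a, m a * Real.logb 2 (R x (z x a))) +
          Real.logb 2 (I + 1 + 1)) := by
      intro x
      by_cases hx : l x = 0
      · simp [hx]
      refine mul_le_mul_of_nonneg_left ?_ (hl0 x)
      refine (weightEntropy_le_zipf (fun b => Finset.sum_nonneg fun a _ => hm0 a)
        (sum_fiber_eq_one hw1 (z x)) (hR x hx).1 (hR x hx).2 (L := I + 1)
        (by linarith)).trans (le_of_eq ?_)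
      congr 2
      rw [← Finset.sum_fiberwise univ (z x)]
      refine Finset.sum_congr rfl fun b _ => ?_
      rw [Finset.sum_mul]
      refine Finset.sum_congr rfl fun a ha => ?_
      rw [(Finset.mem_filter.1 ha).2]
    -- Jensen's inequality on each event that race a is won by b bounds the log rank by log(1 +
    -- Q/P). Its mean exceeds I by at most one bit.
    have hlog : ∑ x, l x * ∑ a, m a * Real.logb 2 (R x (z x a)) ≤ I + 1 := by
      have h1 : ∑ x, l x * ∑ a, m a * Real.logb 2 (R x (z x a)) =
          ∑ a, m a * ∑ b, ∑ x with z x a = b, l x * Real.logb 2 (R x b) := by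
        simp only [Finset.mul_sum]
        rw [Finset.sum_comm]
        refine Finset.sum_congr rfl fun a _ => ?_
        rw [← Finset.sum_fiberwise univ fun x => z x a]
        refine Finset.sum_congr rfl fun b _ => Finset.sum_congr rfl fun x hx => ?_
        rw [(Finset.mem_filter.1 hx).2]
        ring
      have h2 : ∀ a b, ∑ x with z x a = b, l x * Real.logb 2 (R x b) ≤
          Q a b * Real.logb 2 (1 + Q a b / P b) := by
        intro a b
        rcases eq_or_lt_of_le (hQ0 a b) with h | h
        · have h0 := hlQ a b
          rw [← h] at h0
          rw [← h, zero_mul]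
          refine (Finset.sum_eq_zero fun x hx => ?_).le
          rw [(Finset.sum_eq_zero_iff_of_nonneg fun x _ => hl0 x).1 h0 x hx, zero_mul]
        · have hPb := hQP a b h
          refine sum_mul_logb_le _ (fun x _ => hl0 x)
            (fun x _ hx => Nat.cast_pos.2 ((hR x hx).2 b)) (by positivity) (hlQ a b) (hlR a b h)
      have h3 : ∀ a, m a * ∑ b, Q a b * Real.logb 2 (Q a b / P b) =
          ∑ b, w a b * Real.logb 2 (w a b / (m a * P b)) := by
        intro a
        rw [Finset.mul_sum]
        refine Finset.sum_congr rfl fun b _ => ?_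
        rw [← mul_assoc, hwQ a b]
        rcases eq_or_lt_of_le (hw a b) with h | h
        · simp [← h]
        have hma : 0 < m a := h.trans_le (le_rowSum hw a b)
        rw [← hwQ a b]
        congr 2
        exact (mul_div_mul_left _ _ hma.ne').symm
      calc _ ≤ ∑ a, m a * (∑ b, Q a b * Real.logb 2 (Q a b / P b) + 1) := by
            rw [h1]
            refine Finset.sum_le_sum fun a _ => mul_le_mul_of_nonneg_left ?_ (hm0 a)
            exact (Finset.sum_le_sum fun b _ => h2 a b).trans
              (sum_mul_logb_one_add_le hP1 hP0 (hQ0 a) (hQ1 a) (hQP a))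
        _ = I + 1 := by
            simp only [mul_add, mul_one, Finset.sum_add_distrib, h3]
            rw [hw1]
            rfl
    -- The total is (1 + 1/(I+1))(I+1) + log(I+2) ≤ I + 2 + log(I+1) + 1, so the constant 3 would
    -- already do.
    have hfin : Real.logb 2 (I + 1 + 1) ≤ Real.logb 2 (I + 1) + 1 := by
      have h2 : Real.logb 2 (I + 1) + 1 = Real.logb 2 ((I + 1) * 2) := by
        rw [Real.logb_mul (by linarith) two_ne_zero, Real.logb_self_eq_one one_lt_two]
      rw [h2]
      exact Real.logb_le_logb_of_le one_lt_two (by linarith) (by linarith)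
    rw [hcost]
    refine (Finset.sum_le_sum fun x _ => hzipf x).trans ?_
    simp only [mul_add (l _), Finset.sum_add_distrib, ← Finset.sum_mul, hl1, one_mul]
    have h6 : ∑ x, l x * ((1 + 1 / (I + 1)) * ∑ a, m a * Real.logb 2 (R x (z x a))) =
        (1 + 1 / (I + 1)) * ∑ x, l x * ∑ a, m a * Real.logb 2 (R x (z x a)) := by
      rw [Finset.mul_sum]
      exact Finset.sum_congr rfl fun x _ => by ring
    have h7 : (1 + 1 / (I + 1)) * (I + 1) = I + 2 := by
      field_simp
      ring
    have h8 : 0 ≤ 1 + 1 / (I + 1) := by positivity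
    have h9 := mul_le_mul_of_nonneg_left hlog h8
    rw [h6]
    linarith

end SemPriv

namespace SemPriv

open Finset

/-! ### Entropy of images and the coupling with independent coordinates -/

section product

variable {A B : Type*} [Fintype A] [Fintype B] {w : A → B → ℝ}

theorem weightEntropy_image_eq [DecidableEq B] (m : A → ℝ) (z : A → B) :
    (weightEntropy fun b => ∑ a with z a = b, m a) =
      ∑ a, m a * Real.logb 2 (1 / ∑ a' with z a' = z a, m a') := by
  rw [← Finset.sum_fiberwise univ z]
  refine Finset.sum_congr rfl fun b _ => ?_
  rw [Finset.sum_mul]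
  refine Finset.sum_congr rfl fun a ha => ?_
  rw [(Finset.mem_filter.1 ha).2]

theorem le_sum_fiber {A B : Type*} [Fintype A] [DecidableEq B] {m : A → ℝ}
    (hm0 : ∀ a, 0 ≤ m a) (z : A → B) (a : A) : m a ≤ ∑ a' with z a' = z a, m a' :=
  Finset.single_le_sum (fun a' _ => hm0 a') (Finset.mem_filter.2 ⟨mem_univ a, rfl⟩)

theorem weightEntropy_image_le_term {A B : Type*} [Fintype A] [DecidableEq B] {m : A → ℝ}
    (hm0 : ∀ a, 0 ≤ m a) (z : A → B)
    (a : A) : m a * Real.logb 2 (1 / ∑ a' with z a' = z a, m a') ≤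
      m a * Real.logb 2 (1 / m a) := by
  rcases eq_or_lt_of_le (hm0 a) with h | h
  · simp [← h]
  have h1 := le_sum_fiber hm0 z a
  exact mul_le_mul_of_nonneg_left (Real.logb_le_logb_of_le one_lt_two
    (one_div_pos.2 (h.trans_le h1)) (one_div_le_one_div_of_le h h1)) h.le

theorem weightEntropy_image_le [DecidableEq B] {m : A → ℝ} (hm0 : ∀ a, 0 ≤ m a) (z : A → B) :
    (weightEntropy fun b => ∑ a with z a = b, m a) ≤ weightEntropy m := by
  rw [weightEntropy_image_eq]
  exact Finset.sum_le_sum fun a _ => weightEntropy_image_le_term hm0 z a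

theorem weightEntropy_image_lt [DecidableEq B] {m : A → ℝ} (hm0 : ∀ a, 0 ≤ m a) {z : A → B}
    {a₁ a₂ : A} (h₁ : 0 < m a₁) (h₂ : 0 < m a₂) (hne : a₂ ≠ a₁) (hz : z a₂ = z a₁) :
    (weightEntropy fun b => ∑ a with z a = b, m a) < weightEntropy m := by
  classical
  rw [weightEntropy_image_eq]
  refine Finset.sum_lt_sum (fun a _ => weightEntropy_image_le_term hm0 z a)
    ⟨a₁, mem_univ a₁, ?_⟩
  have h3 : m a₁ + m a₂ ≤ ∑ a' with z a' = z a₁, m a' := by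
    rw [← Finset.sum_pair hne.symm]
    refine Finset.sum_le_sum_of_subset_of_nonneg (fun a ha => ?_) fun a _ _ => hm0 a
    rcases Finset.mem_insert.1 ha with rfl | ha
    · simp
    · rw [Finset.mem_singleton.1 ha]
      simp [hz]
  exact mul_lt_mul_of_pos_left (Real.logb_lt_logb one_lt_two
    (one_div_pos.2 (by linarith)) (one_div_lt_one_div_of_lt h₁ (by linarith))) h₁

theorem couplingCost_le (hw : ∀ a b, 0 ≤ w a b) {M : (A → B) → ℝ} (hM : IsCoupling w M) :
    couplingCost w M ≤ weightEntropy fun a => ∑ b, w a b := by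
  classical
  have h : couplingCost w M ≤ ∑ z, M z * weightEntropy fun a => ∑ b, w a b := by
    refine Finset.sum_le_sum fun z _ => mul_le_mul_of_nonneg_left ?_ (hM.nonneg z)
    exact weightEntropy_image_le (fun a => Finset.sum_nonneg fun b _ => hw a b) z
  rwa [← Finset.sum_mul, hM.sum_eq_one, one_mul] at h

theorem couplingCost_lt (hw : ∀ a b, 0 ≤ w a b) {M : (A → B) → ℝ} (hM : IsCoupling w M)
    {z : A → B} (hz : 0 < M z) {a₁ a₂ : A} (h₁ : 0 < ∑ b, w a₁ b) (h₂ : 0 < ∑ b, w a₂ b)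
    (hne : a₂ ≠ a₁) (hza : z a₂ = z a₁) :
    couplingCost w M < weightEntropy fun a => ∑ b, w a b := by
  classical
  have hm0 : ∀ a, 0 ≤ ∑ b, w a b := fun a => Finset.sum_nonneg fun b _ => hw a b
  have h : couplingCost w M < ∑ z, M z * weightEntropy fun a => ∑ b, w a b := by
    refine Finset.sum_lt_sum (fun z _ => mul_le_mul_of_nonneg_left
      (weightEntropy_image_le hm0 z) (hM.nonneg z)) ⟨z, mem_univ z, ?_⟩
    exact mul_lt_mul_of_pos_left (weightEntropy_image_lt hm0 h₁ h₂ hne hza) hz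
  rwa [← Finset.sum_mul, hM.sum_eq_one, one_mul] at h

open Classical in
theorem isCoupling_prod {Q : A → B → ℝ} (hQ0 : ∀ a b, 0 ≤ Q a b) (hQ1 : ∀ a, ∑ b, Q a b = 1)
    (hwQ : ∀ a b, (∑ b', w a b') * Q a b = w a b) :
    IsCoupling w fun z => ∏ a, Q a (z a) := by
  refine ⟨fun z => Finset.prod_nonneg fun a _ => hQ0 a _, ?_, fun a b => ?_⟩
  · rw [← Fintype.piFinset_univ, ← Finset.prod_univ_sum]
    exact Finset.prod_eq_one fun a _ => hQ1 a
  · rw [← hwQ a b]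
    congr 1
    -- The indicator of z a = b is absorbed into the factor at a, so that the sum over z still
    -- factors.
    have h1 : ∀ z : A → B, (if z a = b then ∏ i, Q i (z i) else 0) =
        ∏ i, if i = a ∧ z i ≠ b then 0 else Q i (z i) := by
      intro z
      split_ifs with h
      · refine Finset.prod_congr rfl fun i _ => ?_
        rw [if_neg]
        rintro ⟨rfl, h2⟩
        exact h2 h
      · symm
        refine Finset.prod_eq_zero (mem_univ a) ?_
        rw [if_pos ⟨rfl, h⟩]
    rw [Finset.sum_filter]
    simp only [h1]
    rw [← Fintype.piFinset_univ,
      ← Finset.prod_univ_sum (fun _ => univ) fun i j => if i = a ∧ j ≠ b then 0 else Q i j,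
      Finset.prod_eq_single a]
    · rw [Finset.sum_eq_single b]
      · simp
      · intro b' _ hb'
        simp [hb']
      · simp
    · intro i _ hi
      simp [hi, hQ1]
    · simp

/-- Independent coordinates charge every function whose values are all possible, in particular one
that sends two rows compatible with the same b to b. That function strictly loses entropy. -/
theorem exists_coupling_cost_lt (hw : ∀ a b, 0 ≤ w a b) (hw1 : ∑ a, ∑ b, w a b = 1)
    (h : weightCondEntropy (fun b a => w a b) ≠ 0) :
    ∃ M, IsCoupling w M ∧ couplingCost w M < weightEntropy fun a => ∑ b, w a b := by
  classical
  obtain ⟨Q, hQ0, hQ1, hwQ, -⟩ := exists_conditional hw hw1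
  have hM := isCoupling_prod hQ0 hQ1 hwQ
  rw [Ne, weightCondEntropy_eq_zero_iff fun b a => hw a b] at h
  push Not at h
  obtain ⟨b, a₁, h1, h2⟩ := h
  obtain ⟨a₂, hne, h3⟩ : ∃ a₂, a₂ ≠ a₁ ∧ 0 < w a₂ b := by
    by_contra! h3
    refine h2 (Finset.sum_eq_single (f := fun a => w a b) a₁ (fun a _ ha => ?_)
      fun h => absurd (mem_univ _) h).symm
    exact le_antisymm (h3 a ha) (hw a b)
  have hpos : ∀ a, 0 < w a b → 0 < Q a b := by
    intro a ha
    refine lt_of_le_of_ne (hQ0 a b) fun h0 => ?_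
    rw [← hwQ a b, ← h0, mul_zero] at ha
    exact lt_irrefl _ ha
  have hex : ∀ a, ∃ b, 0 < Q a b := by
    intro a
    by_contra! h4
    have := Finset.sum_nonpos fun b (_ : b ∈ univ) => h4 b
    rw [hQ1] at this
    linarith
  choose y hy using hex
  -- The merging function takes the value b wherever b is possible, and any letter of positive
  -- probability elsewhere.
  refine ⟨_, hM, couplingCost_lt hw hM (z := fun a => if 0 < w a b then b else y a) ?_
    (h1.trans_le (le_rowSum hw a₁ b)) (h3.trans_le (le_rowSum hw a₂ b)) hne ?_⟩
  · refine Finset.prod_pos fun a _ => ?_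
    beta_reduce
    split_ifs with h5
    · exact hpos a h5
    · exact hy a
  · simp [h1, h3]

end product

/-! ### Mechanisms -/

section mechanism

variable {A B : Type*} [Fintype A] [Fintype B]

open Classical in
/-- The joint weight of `a`, `b` and the message that reveals `b` with probability `c` and otherwise
reveals a random function, distributed according to `M`, that takes `a` to `b`. -/
noncomputable def mixedWeight (w : A → B → ℝ) (M : (A → B) → ℝ) (c : ℝ) (a : A) (b : B) :
    B ⊕ (A → B) → ℝ
  | .inl b' => if b' = b then c * w a b else 0
  | .inr z => if z a = b then (1 - c) * ((∑ b', w a b') * M z) else 0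

variable {w : A → B → ℝ} {M : (A → B) → ℝ} {c : ℝ}

theorem mixedWeight_nonneg (hw : ∀ a b, 0 ≤ w a b) (hM : IsCoupling w M) (hc0 : 0 ≤ c)
    (hc1 : c ≤ 1) (a : A) (b : B) (v : B ⊕ (A → B)) : 0 ≤ mixedWeight w M c a b v := by
  rcases v with b' | z
  · simp only [mixedWeight]
    split_ifs
    · exact mul_nonneg hc0 (hw a b)
    · exact le_rfl
  · simp only [mixedWeight]
    split_ifs
    · exact mul_nonneg (by linarith)
        (mul_nonneg (Finset.sum_nonneg fun b _ => hw a b) (hM.nonneg z))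
    · exact le_rfl

open Classical in
theorem sum_mixedWeight (hM : IsCoupling w M) (a : A) (b : B) :
    ∑ v, mixedWeight w M c a b v = w a b := by
  rw [Fintype.sum_sum_type]
  have h1 : ∑ b', mixedWeight w M c a b (.inl b') = c * w a b := by
    simp [mixedWeight]
  have h2 : ∑ z, mixedWeight w M c a b (.inr z) = (1 - c) * w a b := by
    rw [← hM.rowSum_mul a b, Finset.mul_sum, Finset.mul_sum, Finset.sum_filter]
    exact Finset.sum_congr rfl fun z _ => by simp [mixedWeight]
  rw [h1, h2]
  ring

open Classical in
-- The choice of branch and the random function are both independent of the row, so only the branch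
-- revealing b leaks, with weight c.
theorem weightInfo_mixedWeight_fst (hM : IsCoupling w M) (hw1 : ∑ a, ∑ b, w a b = 1) :
    weightInfo (fun a v => ∑ b, mixedWeight w M c a b v) = c * weightInfo w := by
  have hl : ∀ a b', ∑ b, mixedWeight w M c a b (.inl b') = c * w a b' := by
    intro a b'
    simp [mixedWeight]
  have hr : ∀ a z, ∑ b, mixedWeight w M c a b (.inr z) = (1 - c) * ((∑ b', w a b') * M z) := by
    intro a z
    simp [mixedWeight]
  have hrow : ∀ a, ∑ v, ∑ b, mixedWeight w M c a b v = ∑ b, w a b := by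
    intro a
    rw [Finset.sum_comm]
    exact Finset.sum_congr rfl fun b _ => sum_mixedWeight hM a b
  unfold weightInfo
  rw [Finset.mul_sum]
  refine Finset.sum_congr rfl fun a _ => ?_
  rw [Fintype.sum_sum_type, Finset.mul_sum]
  simp only [hrow, hl, hr]
  have h2 : ∀ z, (1 - c) * ((∑ b, w a b) * M z) * Real.logb 2 ((1 - c) * ((∑ b, w a b) * M z) /
      ((∑ b, w a b) * ∑ a', (1 - c) * ((∑ b, w a' b) * M z))) = 0 := by
    intro z
    rw [← Finset.mul_sum, ← Finset.sum_mul, hw1, one_mul]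
    by_cases h0 : (1 - c) * ((∑ b, w a b) * M z) = 0
    · rw [h0, zero_mul]
    · rw [show (∑ b, w a b) * ((1 - c) * M z) = (1 - c) * ((∑ b, w a b) * M z) by ring,
        div_self h0, Real.logb_one, mul_zero]
  rw [Finset.sum_congr rfl fun z _ => h2 z, Finset.sum_const_zero, add_zero]
  refine Finset.sum_congr rfl fun b _ => ?_
  by_cases hc : c = 0
  · simp [hc]
  rw [← Finset.mul_sum, mul_left_comm (∑ b, w a b) c, mul_div_mul_left _ _ hc, mul_assoc]

open Classical in
-- Given a revealed b nothing remains uncertain. Given a revealed z, the column has the law of z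
-- applied to the row, whose mean entropy over z is the coupling cost.
theorem weightInfo_mixedWeight_snd (hw : ∀ a b, 0 ≤ w a b) (hM : IsCoupling w M)
    (hw1 : ∑ a, ∑ b, w a b = 1) :
    weightInfo (fun b v => ∑ a, mixedWeight w M c a b v) =
      weightEntropy (fun b => ∑ a, w a b) - (1 - c) * couplingCost w M := by
  set m : A → ℝ := fun a => ∑ b, w a b with hm
  set P : B → ℝ := fun b => ∑ a, w a b with hP
  have hm0 : ∀ a, 0 ≤ m a := fun a => Finset.sum_nonneg fun b _ => hw a b
  have hP0 : ∀ b, 0 ≤ P b := fun b => Finset.sum_nonneg fun a _ => hw a b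
  set g : (A → B) → B → ℝ := fun z b => ∑ a with z a = b, m a with hg
  have hg0 : ∀ z b, 0 ≤ g z b := fun z b => Finset.sum_nonneg fun a _ => hm0 a
  have hg1 : ∀ z, ∑ b, g z b = 1 := fun z => sum_fiber_eq_one hw1 z
  have hgP : ∀ b, ∑ z, M z * g z b = P b := by
    intro b
    have : ∀ z, M z * g z b = ∑ a, if z a = b then m a * M z else 0 := by
      intro z
      rw [hg, Finset.mul_sum, Finset.sum_filter]
      exact Finset.sum_congr rfl fun a _ => by split_ifs <;> ring
    simp only [this]
    rw [Finset.sum_comm]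
    refine Finset.sum_congr rfl fun a _ => ?_
    rw [← hM.rowSum_mul a b, Finset.mul_sum, Finset.sum_filter]
  have hl : ∀ b b', ∑ a, mixedWeight w M c a b (.inl b') = if b' = b then c * P b else 0 := by
    intro b b'
    simp only [mixedWeight]
    split_ifs
    · rw [← Finset.mul_sum]
    · simp
  have hr : ∀ b z, ∑ a, mixedWeight w M c a b (.inr z) = (1 - c) * (M z * g z b) := by
    intro b z
    simp only [mixedWeight, hg]
    rw [← Finset.sum_filter, Finset.mul_sum, Finset.mul_sum]
    exact Finset.sum_congr rfl fun a _ => by ring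
  have hrow : ∀ b, ∑ v, ∑ a, mixedWeight w M c a b v = P b := by
    intro b
    rw [Finset.sum_comm]
    exact Finset.sum_congr rfl fun a _ => sum_mixedWeight hM a b
  have hcost : couplingCost w M = ∑ b, ∑ z, M z * (g z b * Real.logb 2 (1 / g z b)) := by
    rw [Finset.sum_comm]
    unfold couplingCost weightEntropy
    refine Finset.sum_congr rfl fun z _ => ?_
    rw [Finset.mul_sum]
  rw [hcost, weightEntropy, weightInfo, Finset.mul_sum, ← Finset.sum_sub_distrib]
  refine Finset.sum_congr rfl fun b _ => ?_
  rw [Fintype.sum_sum_type]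
  simp only [hrow, hl, hr]
  have h1 : ∑ b', (if b' = b then c * P b else 0) * Real.logb 2
      ((if b' = b then c * P b else 0) / (P b * ∑ b'', if b' = b'' then c * P b'' else 0)) =
      c * (P b * Real.logb 2 (1 / P b)) := by
    rw [Finset.sum_eq_single b]
    · simp only [if_true, Finset.sum_ite_eq, mem_univ]
      by_cases h0 : c * P b = 0
      · rw [h0, zero_mul, ← mul_assoc, h0, zero_mul]
      · rw [← div_div, div_right_comm, div_self h0, mul_assoc]
    · intro b' _ hb'
      simp [hb']
    · simp
  have h2 : ∀ z, (1 - c) * (M z * g z b) * Real.logb 2 ((1 - c) * (M z * g z b) /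
      (P b * ∑ b', (1 - c) * (M z * g z b'))) =
      (1 - c) * (M z * g z b * Real.logb 2 (1 / P b) -
        M z * (g z b * Real.logb 2 (1 / g z b))) := by
    intro z
    rw [← Finset.mul_sum, ← Finset.mul_sum, hg1, mul_one]
    by_cases hc : 1 - c = 0
    · simp [hc]
    rcases eq_or_lt_of_le (hM.nonneg z) with h0 | h0
    · simp [← h0]
    rcases eq_or_lt_of_le (hg0 z b) with h3 | h3
    · simp [← h3]
    have hPb : 0 < P b := by
      rw [← hgP b]
      exact (mul_pos h0 h3).trans_le (Finset.single_le_sum (f := fun z => M z * g z b)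
        (fun z _ => mul_nonneg (hM.nonneg z) (hg0 z b)) (mem_univ z))
    have h4 : (1 - c) * (M z * g z b) / (P b * ((1 - c) * M z)) = g z b / P b := by
      field_simp
    rw [h4, Real.logb_div h3.ne' hPb.ne', Real.logb_div one_ne_zero hPb.ne',
      Real.logb_div one_ne_zero h3.ne', Real.logb_one]
    ring
  rw [h1, Finset.sum_congr rfl fun z _ => h2 z, ← Finset.mul_sum, Finset.sum_sub_distrib,
    ← Finset.sum_mul, hgP]
  ring

end mechanism

theorem exists_pmf_mul_eq {V : Type*} [Fintype V] [Nonempty V] {r : V → ℝ} {c : ℝ}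
    (hr0 : ∀ v, 0 ≤ r v) (hr : ∑ v, r v = c) : ∃ W : PMF V, ∀ v, c * (W v).toReal = r v := by
  have hc0 : 0 ≤ c := hr ▸ Finset.sum_nonneg fun v _ => hr0 v
  rcases eq_or_lt_of_le hc0 with hc | hc
  · refine ⟨PMF.pure (Classical.arbitrary V), fun v => ?_⟩
    rw [← hc] at hr
    rw [← hc, zero_mul, (Finset.sum_eq_zero_iff_of_nonneg fun v _ => hr0 v).1 hr v (mem_univ v)]
  · refine ⟨PMF.ofFintype (fun v => ENNReal.ofReal (r v / c)) ?_, fun v => ?_⟩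
    · rw [← ENNReal.ofReal_sum_of_nonneg fun v _ => div_nonneg (hr0 v) hc0, ← Finset.sum_div, hr,
        div_self hc.ne', ENNReal.ofReal_one]
    · rw [PMF.ofFintype_apply, ENNReal.toReal_ofReal (div_nonneg (hr0 v) hc0),
        mul_div_cancel₀ _ hc.ne']

end SemPriv

namespace SemPriv

open Finset

/-! ### The disclosure problem -/

section disclosure

variable {𝒮 𝒳 𝒵 B : Type*} [Fintype 𝒮] [Fintype B]
  (P : PMF (𝒮 × 𝒳)) (f : 𝒳 → ℝ) {h : 𝒳 → 𝒵} {k : 𝒳 → B} {e : B → 𝒵}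

/-- The joint weight of `S` and the label `k X`. -/
noncomputable def labelWeight (P : PMF (𝒮 × 𝒳)) (k : 𝒳 → B) (s : 𝒮) (b : B) : ℝ :=
  (P.map (fun ω => (ω.1, k ω.2)) (s, b)).toReal

omit [Fintype 𝒮] [Fintype B] in
theorem labelWeight_nonneg (k : 𝒳 → B) (s : 𝒮) (b : B) : 0 ≤ labelWeight P k s b :=
  ENNReal.toReal_nonneg

theorem sum_labelWeight (k : 𝒳 → B) : ∑ s, ∑ b, labelWeight P k s b = 1 := by
  rw [← Fintype.sum_prod_type']
  exact sum_toReal _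

theorem entS_semanticLaw (h : 𝒳 → 𝒵) (k : 𝒳 → B) :
    entS (semanticLaw P f h) = weightEntropy fun s => ∑ b, labelWeight P k s b := by
  have : ((semanticLaw P f h).map fun t => t.1) =
      (P.map fun ω => (ω.1, k ω.2)).map Prod.fst := by
    rw [semanticLaw, PMF.map_comp, PMF.map_comp]; rfl
  rw [entS, this, entropy_eq_weightEntropy]
  simp only [toReal_map_fst]
  rfl

theorem entH_semanticLaw (he : e.Injective) (hk : ∀ x, h x = e (k x)) :
    entH (semanticLaw P f h) = weightEntropy fun b => ∑ s, labelWeight P k s b := by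
  obtain rfl : h = e ∘ k := funext hk
  have : ((semanticLaw P f (e ∘ k)).map fun t => t.2.2) =
      ((P.map fun ω => (ω.1, k ω.2)).map Prod.snd).map e := by
    rw [semanticLaw, PMF.map_comp, PMF.map_comp, PMF.map_comp]; rfl
  rw [entH, this, entropy_map_of_injective _ he, entropy_eq_weightEntropy]
  simp only [toReal_map_snd]
  rfl

theorem entHGivenS_semanticLaw (he : e.Injective) (hk : ∀ x, h x = e (k x)) :
    entHGivenS (semanticLaw P f h) = weightCondEntropy (labelWeight P k) := by
  obtain rfl : h = e ∘ k := funext hk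
  have : ((semanticLaw P f (e ∘ k)).map fun t => (t.2.2, t.1)) =
      ((P.map fun ω => (ω.1, k ω.2)).map Prod.swap).map (Prod.map e id) := by
    rw [semanticLaw, PMF.map_comp, PMF.map_comp, PMF.map_comp]; rfl
  rw [entHGivenS, this, condEntropy_map_of_injective _ he Function.injective_id,
    condEntropy_eq_weightCondEntropy]
  congr
  funext s b
  exact congrArg ENNReal.toReal (map_apply_of_injective _ Prod.swap_injective (s, b))

theorem entSGivenH_semanticLaw (he : e.Injective) (hk : ∀ x, h x = e (k x)) :
    entSGivenH (semanticLaw P f h) = weightCondEntropy fun b s => labelWeight P k s b := by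
  obtain rfl : h = e ∘ k := funext hk
  have : ((semanticLaw P f (e ∘ k)).map fun t => (t.1, t.2.2)) =
      (P.map fun ω => (ω.1, k ω.2)).map (Prod.map id e) := by
    rw [semanticLaw, PMF.map_comp, PMF.map_comp]; rfl
  rw [entSGivenH, this, condEntropy_map_of_injective _ Function.injective_id he,
    condEntropy_eq_weightCondEntropy]
  rfl

theorem infoSH_semanticLaw (he : e.Injective) (hk : ∀ x, h x = e (k x)) :
    infoSH (semanticLaw P f h) = weightInfo (labelWeight P k) := by
  obtain rfl : h = e ∘ k := funext hk
  have : ((semanticLaw P f (e ∘ k)).map fun t => (t.1, t.2.2)) =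
      (P.map fun ω => (ω.1, k ω.2)).map (Prod.map id e) := by
    rw [semanticLaw, PMF.map_comp, PMF.map_comp]; rfl
  rw [infoSH, this, mutualInfo_map_of_injective _ Function.injective_id he,
    mutualInfo_eq_weightInfo]
  rfl

/-- The joint law of `S`, the label `k X` and the disclosed variable. -/
noncomputable def labelDisclosedLaw (h : 𝒳 → 𝒵) (k : 𝒳 → B) (Q : 𝒮 × ℝ × 𝒵 → PMF ℝ) :
    PMF (𝒮 × B × ℝ) :=
  P.bind fun ω => (Q (ω.1, f ω.2, h ω.2)).map fun u => (ω.1, k ω.2, u)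

omit [Fintype 𝒮] [Fintype B] in
theorem leakage_eq (h : 𝒳 → 𝒵) (k : 𝒳 → B) (Q : 𝒮 × ℝ × 𝒵 → PMF ℝ) :
    leakage (semanticLaw P f h) Q =
      mutualInfo ((labelDisclosedLaw P f h k Q).map fun x => (x.1, x.2.2)) := by
  rw [leakage, disclosedLaw, semanticLaw, PMF.bind_map, labelDisclosedLaw, PMF.map_bind,
    PMF.map_bind]
  simp only [PMF.map_comp, Function.comp_def]

omit [Fintype 𝒮] [Fintype B] in
theorem utility_eq (he : e.Injective) (hk : ∀ x, h x = e (k x)) (Q : 𝒮 × ℝ × 𝒵 → PMF ℝ) :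
    utility (semanticLaw P f h) Q =
      mutualInfo ((labelDisclosedLaw P f h k Q).map fun x => (x.2.1, x.2.2)) := by
  obtain rfl : h = e ∘ k := funext hk
  rw [← mutualInfo_map_of_injective _ he (Function.injective_id (α := ℝ)), utility, disclosedLaw,
    semanticLaw, PMF.bind_map, labelDisclosedLaw, PMF.map_bind, PMF.map_bind, PMF.map_bind]
  simp only [PMF.map_comp, Function.comp_def, Prod.map, id]

theorem utility_le (he : e.Injective) (hk : ∀ x, h x = e (k x)) (Q : 𝒮 × ℝ × 𝒵 → PMF ℝ) :
    utility (semanticLaw P f h) Q ≤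
      entHGivenS (semanticLaw P f h) + leakage (semanticLaw P f h) Q := by
  have h1 := mutualInfo_le_add_condEntropy (labelDisclosedLaw P f h k Q)
  have h2 : ((labelDisclosedLaw P f h k Q).map fun x => (x.2.1, x.1)) =
      (P.map fun ω => (ω.1, k ω.2)).map Prod.swap := by
    rw [labelDisclosedLaw, PMF.map_bind, PMF.map_comp]
    simp only [PMF.map_comp, Function.comp_def]
    exact (congrArg P.bind (funext fun ω => PMF.map_const _ _)).trans (PMF.bind_pure_comp _ _)
  have h3 : entHGivenS (semanticLaw P f h) =
      condEntropy ((P.map fun ω => (ω.1, k ω.2)).map Prod.swap) := by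
    rw [entHGivenS_semanticLaw P f he hk, condEntropy_eq_weightCondEntropy]
    congr
    funext s b
    exact (congrArg ENNReal.toReal (map_apply_of_injective _ Prod.swap_injective (s, b))).symm
  rw [utility_eq P f he hk, leakage_eq P f h k, h3, ← h2]
  linarith

/-- Every finite joint weight of `S`, `h X` and a message is realized by a mechanism. -/
theorem exists_mechanism [Nonempty B] (he : e.Injective) (hk : ∀ x, h x = e (k x))
    {V : Type*} [Fintype V] [Nonempty V] {r : 𝒮 → B → V → ℝ} (hr0 : ∀ s b v, 0 ≤ r s b v)
    (hr : ∀ s b, ∑ v, r s b v = labelWeight P k s b) :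
    ∃ Q : 𝒮 × ℝ × 𝒵 → PMF ℝ,
      leakage (semanticLaw P f h) Q = weightInfo (fun s v => ∑ b, r s b v) ∧
      utility (semanticLaw P f h) Q = weightInfo (fun b v => ∑ s, r s b v) := by
  choose W hW using fun s b => exists_pmf_mul_eq (hr0 s b) (hr s b)
  let enc : V → ℝ := fun v => ((Fintype.equivFin V v : ℕ) : ℝ)
  have henc : enc.Injective := fun v v' hv =>
    (Fintype.equivFin V).injective (Fin.val_injective (Nat.cast_injective hv))
  -- The mechanism ignores f(X), recovers the label from h(X) and encodes the finite message
  -- injectively as a real number.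
  let Q : 𝒮 × ℝ × 𝒵 → PMF ℝ := fun t => (W t.1 (Function.invFun e t.2.2)).map enc
  let J : PMF (𝒮 × B × V) :=
    (P.map fun ω => (ω.1, k ω.2)).bind fun x => (W x.1 x.2).map fun v => (x.1, x.2, v)
  have hJ : ∀ s b v, (J (s, b, v)).toReal = r s b v := by
    classical
    intro s b v
    have hzero : ∀ x : 𝒮 × B, x ≠ (s, b) →
        ((W x.1 x.2).map fun v => (x.1, x.2, v)) (s, b, v) = 0 := by
      intro x hx
      refine map_apply_of_notMem_range _ ?_
      rintro ⟨v', hv'⟩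
      simp only [Prod.mk.injEq] at hv'
      exact hx (Prod.ext hv'.1 hv'.2.1)
    have hinj : Function.Injective fun v : V => (s, b, v) := fun v v' hv => by simpa using hv
    rw [PMF.bind_apply, tsum_eq_single (s, b) fun x hx => by rw [hzero x hx, mul_zero],
      ENNReal.toReal_mul, map_apply_of_injective (W s b) hinj v, ← hW s b v]
    rfl
  have hJQ : labelDisclosedLaw P f h k Q = J.map fun x => (x.1, x.2.1, enc x.2.2) := by
    rw [labelDisclosedLaw, PMF.map_bind, PMF.bind_map]
    simp only [PMF.map_comp, Function.comp_def, Q, hk, Function.leftInverse_invFun he _]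
  refine ⟨Q, ?_, ?_⟩
  · rw [leakage_eq P f h k, hJQ, PMF.map_comp]
    have : J.map ((fun x : 𝒮 × B × ℝ => (x.1, x.2.2)) ∘ fun x => (x.1, x.2.1, enc x.2.2)) =
        (J.map fun x => (x.1, x.2.2)).map (Prod.map id enc) := by
      rw [PMF.map_comp]; rfl
    rw [this, mutualInfo_map_of_injective _ Function.injective_id henc, mutualInfo_eq_weightInfo]
    simp only [toReal_map_fst_thd, hJ]
  · rw [utility_eq P f he hk, hJQ, PMF.map_comp]
    have : J.map ((fun x : 𝒮 × B × ℝ => (x.2.1, x.2.2)) ∘ fun x => (x.1, x.2.1, enc x.2.2)) =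
        (J.map Prod.snd).map (Prod.map id enc) := by
      rw [PMF.map_comp]; rfl
    rw [this, mutualInfo_map_of_injective _ Function.injective_id henc, mutualInfo_eq_weightInfo]
    simp only [toReal_map_snd, hJ]

/-- The mixing probability c = ε/I makes the leakage exactly ε; the utility is rewritten with H(B) =
H(B|A) + I and (1 - c) I = I - ε. -/
theorem mem_achievable_of_isCoupling [Nonempty B] (he : e.Injective) (hk : ∀ x, h x = e (k x))
    {ε : ℝ} (hε₀ : 0 ≤ ε) (hε : ε < infoSH (semanticLaw P f h)) {M : (𝒮 → B) → ℝ}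
    (hM : IsCoupling (labelWeight P k) M) :
    entHGivenS (semanticLaw P f h) + ε - (1 - ε / infoSH (semanticLaw P f h)) *
      (couplingCost (labelWeight P k) M - infoSH (semanticLaw P f h)) ∈
      achievable ε (semanticLaw P f h) := by
  classical
  set I := infoSH (semanticLaw P f h) with hI
  have hI0 : 0 < I := hε₀.trans_lt hε
  have hw := labelWeight_nonneg P k
  have hw1 := sum_labelWeight P k
  have hIw : I = weightInfo (labelWeight P k) := infoSH_semanticLaw P f he hk
  obtain ⟨Q, hQ1, hQ2⟩ := exists_mechanism P f he hk
    (mixedWeight_nonneg hw hM (div_nonneg hε₀ hI0.le) ((div_le_one hI0).2 hε.le))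
    (sum_mixedWeight hM)
  refine ⟨Q, ?_, ?_⟩
  · rw [hQ1, weightInfo_mixedWeight_fst hM hw1, ← hIw, div_mul_cancel₀ _ hI0.ne']
  · rw [hQ2, weightInfo_mixedWeight_snd hw hM hw1]
    have h1 := weightInfo_eq_sub hw
    rw [← hIw, ← entHGivenS_semanticLaw P f he hk] at h1
    have h2 : (1 - ε / I) * I = I - ε := by field_simp
    linear_combination (norm := ring_nf) h1 + h2

theorem entSGivenH_eq_zero_iff (he : e.Injective) (hk : ∀ x, h x = e (k x)) :
    entSGivenH (semanticLaw P f h) = 0 ↔ ∃ φ : 𝒵 → 𝒮, ∀ ω ∈ P.support, ω.1 = φ (h ω.2) := by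
  classical
  have hw := labelWeight_nonneg P k
  rw [entSGivenH_semanticLaw P f he hk, weightCondEntropy_eq_zero_iff fun b s => hw s b]
  have hpos : ∀ s b, 0 < labelWeight P k s b ↔ ∃ ω ∈ P.support, ω.1 = s ∧ k ω.2 = b := by
    intro s b
    rw [labelWeight, ENNReal.toReal_pos_iff, and_iff_left (PMF.apply_lt_top _ _),
      PMF.apply_pos_iff, PMF.support_map]
    simp [Prod.ext_iff]
  obtain ⟨ω₀, hω₀⟩ := P.support_nonempty
  constructor
  · intro h1
    have huniq : ∀ b s s', 0 < labelWeight P k s b → 0 < labelWeight P k s' b → s = s' := by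
      intro b s s' hs hs'
      by_contra hne
      have h2 := h1 b s hs
      have h3 : labelWeight P k s b + labelWeight P k s' b ≤ ∑ s, labelWeight P k s b := by
        rw [← Finset.sum_pair (f := fun s => labelWeight P k s b) hne]
        exact Finset.sum_le_sum_of_subset_of_nonneg (Finset.subset_univ _) fun s _ _ => hw s b
      linarith
    -- Only the values of h on the support matter; elsewhere φ takes an arbitrary default.
    refine ⟨fun y => if hy : ∃ s, ∃ ω ∈ P.support, ω.1 = s ∧ h ω.2 = y then hy.choose else ω₀.1,
      fun ω hω => ?_⟩
    have hy : ∃ s, ∃ ω' ∈ P.support, ω'.1 = s ∧ h ω'.2 = h ω.2 := ⟨ω.1, ω, hω, rfl, rfl⟩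
    beta_reduce
    rw [dif_pos hy]
    obtain ⟨ω', hω', hs, hh⟩ := hy.choose_spec
    rw [hk, hk] at hh
    exact huniq (k ω.2) _ _ ((hpos _ _).2 ⟨ω, hω, rfl, rfl⟩) ((hpos _ _).2 ⟨ω', hω', hs, he hh⟩)
  · rintro ⟨φ, hφ⟩ b s hs
    have hdet : ∀ s, 0 < labelWeight P k s b → s = φ (e b) := by
      intro s hs
      obtain ⟨ω, hω, rfl, rfl⟩ := (hpos s b).1 hs
      rw [hφ ω hω, hk]
    refine (Finset.sum_eq_single (f := fun s => labelWeight P k s b) s (fun s' _ hs' => ?_)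
      fun h => absurd (mem_univ _) h).symm
    by_contra h0
    have h2 := lt_of_le_of_ne (hw s' b) (Ne.symm h0)
    exact hs' ((hdet s' h2).trans (hdet s hs).symm)

end disclosure

/-- Replaces the infinite codomain of h by its finite range; the form `Fin (n + 1)` is the nonempty
alphabet that the races require. -/
theorem exists_labels {𝒳 𝒵 : Type*} [Finite 𝒳] [Nonempty 𝒳] (h : 𝒳 → 𝒵) :
    ∃ (n : ℕ) (k : 𝒳 → Fin (n + 1)) (e : Fin (n + 1) → 𝒵), e.Injective ∧ ∀ x, h x = e (k x) := by
  have hne : Nat.card (Set.range h) ≠ 0 :=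
    Nat.card_ne_zero.2 ⟨(Set.range_nonempty h).to_subtype, inferInstance⟩
  obtain ⟨n, hn⟩ := Nat.exists_eq_succ_of_ne_zero hne
  let E : Set.range h ≃ Fin (n + 1) := Finite.equivFinOfCardEq hn
  exact ⟨n, fun x => E ⟨h x, x, rfl⟩, fun i => (E.symm i : 𝒵),
    Subtype.val_injective.comp E.symm.injective, fun x => by simp⟩

theorem L3_le {𝒮 𝒵 : Type*} [Fintype 𝒮] {ε : ℝ} (hε₀ : 0 ≤ ε)
    (p : PMF (𝒮 × ℝ × 𝒵)) (hne : (separations p).Nonempty) :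
    L3 ε p hne ≤ entHGivenS p + ε - gap p := by
  have h : 0 ≤ (separations p).inf' hne fun g => (ε / entS₂ p g) * entS₂GivenH p g :=
    Finset.le_inf' _ _ fun g _ =>
      mul_nonneg (div_nonneg hε₀ (entropy_nonneg _)) (condEntropy_nonneg _)
  unfold L3
  linarith

/-- Admissibility puts each coefficient in [0, 1], so the quantity subtracted is a convex
combination of H(S|h(X)) and the gap, hence at least their minimum. -/
theorem L4_le {𝒮 𝒵 : Type*} [Fintype 𝒮] {ε : ℝ} (hε₀ : 0 ≤ ε)
    (p : PMF (𝒮 × ℝ × 𝒵)) (hne : (admissibleSeparations ε p).Nonempty) :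
    L4 ε p hne ≤ entHGivenS p + ε - min (entSGivenH p) (gap p) := by
  have h : min (entSGivenH p) (gap p) - gap p ≤ (admissibleSeparations ε p).inf' hne fun g =>
      (ε / entS₂ p g) * (entSGivenH p - gap p) := by
    refine Finset.le_inf' _ _ fun g hg => ?_
    have h1 : ε / entS₂ p g ≤ 1 := (Finset.mem_filter.1 hg).2
    have h0 : 0 ≤ ε / entS₂ p g := div_nonneg hε₀ (entropy_nonneg _)
    rcases le_total (entSGivenH p) (gap p) with h2 | h2
    · rw [min_eq_left h2]
      nlinarith
    · rw [min_eq_right h2, sub_self]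
      exact mul_nonneg h0 (by linarith)
  unfold L4
  linarith

end SemPriv

open SemPriv in
theorem theorem1 {𝒮 : Type*} [Fintype 𝒮] {N K : ℕ} {𝒳 : Fin N → Type*} [∀ i, Fintype (𝒳 i)]
    (P : PMF (𝒮 × (∀ i, 𝒳 i))) (f : (∀ i, 𝒳 i) → ℝ) (h : (∀ i, 𝒳 i) → Fin K → ℝ)
    (p : PMF (𝒮 × ℝ × (Fin K → ℝ))) (hp : p = SemPriv.semanticLaw P f h)
    (ε : ℝ) (hε₀ : 0 ≤ ε) (hε : ε < SemPriv.infoSH p) :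
    -- the supremum that defines the optimal utility exists
    IsLUB (SemPriv.achievable ε p) (SemPriv.optUtility ε p) ∧
    -- the upper bound
    SemPriv.optUtility ε p ≤ SemPriv.entHGivenS p + ε ∧
    -- the four lower bounds
    SemPriv.L1 ε p = SemPriv.entH p - SemPriv.entS p + ε ∧
    SemPriv.L1 ε p ≤ SemPriv.optUtility ε p ∧
    SemPriv.L2 ε p ≤ SemPriv.optUtility ε p ∧
    (∀ hne : (SemPriv.separations p).Nonempty,
      SemPriv.L3 ε p hne ≤ SemPriv.optUtility ε p) ∧
    (∀ hne : (SemPriv.admissibleSeparations ε p).Nonempty,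
      SemPriv.L4 ε p hne ≤ SemPriv.optUtility ε p) ∧
    -- tightness
    (SemPriv.entSGivenH p = 0 ↔
      ∃ φ : (Fin K → ℝ) → 𝒮, ∀ sx ∈ P.support, sx.1 = φ (h sx.2)) ∧
    (SemPriv.entSGivenH p = 0 →
      SemPriv.optUtility ε p = SemPriv.L1 ε p ∧
      SemPriv.optUtility ε p = SemPriv.entHGivenS p + ε) ∧
    (SemPriv.optUtility ε p = SemPriv.L1 ε p → SemPriv.entSGivenH p = 0) := by
  subst hp
  obtain ⟨ω₀, -⟩ := P.support_nonempty
  have : Nonempty (∀ i, 𝒳 i) := ⟨ω₀.2⟩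
  obtain ⟨n, k, e, he, hk⟩ := exists_labels h
  have hIw := infoSH_semanticLaw P f he hk
  have hSw := entS_semanticLaw P f h k
  have hHw := entH_semanticLaw P f he hk
  have hHSw := entHGivenS_semanticLaw P f he hk
  have hSHw := entSGivenH_semanticLaw P f he hk
  have hmem : ∀ {M : (𝒮 → Fin (n + 1)) → ℝ}, IsCoupling (labelWeight P k) M → _ := fun hM =>
    mem_achievable_of_isCoupling P f he hk hε₀ hε hM
  have hzero := entSGivenH_eq_zero_iff P f he hk
  have hbound : ∀ v ∈ achievable ε (semanticLaw P f h),
      v ≤ entHGivenS (semanticLaw P f h) + ε := by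
    rintro v ⟨Q, hQ, rfl⟩
    exact (utility_le P f he hk Q).trans (by linarith)
  have hw := labelWeight_nonneg P k
  have hw1 := sum_labelWeight P k
  obtain ⟨M, hM, hMcost⟩ := exists_coupling_cost_le hw hw1
  have hMS := couplingCost_le hw hM
  have hprod := exists_coupling_cost_lt hw hw1
  have hI1 := weightInfo_eq_sub hw
  have hI2 := weightInfo_eq_sub' hw
  have hSH0 : 0 ≤ entSGivenH (semanticLaw P f h) := condEntropy_nonneg _
  rw [← hIw] at hMcost
  rw [← hSw] at hMS hprod
  rw [← hHSw, ← hHw, ← hIw] at hI1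
  rw [← hSHw, ← hSw, ← hIw] at hI2
  rw [← hSHw] at hprod
  have hL3 : ∀ hne, L3 ε (semanticLaw P f h) hne ≤ _ := L3_le hε₀ (semanticLaw P f h)
  have hL4 : ∀ hne, L4 ε (semanticLaw P f h) hne ≤ _ := L4_le hε₀ (semanticLaw P f h)
  -- What remains is arithmetic with the collected identities and inequalities.
  generalize semanticLaw P f h = p at *
  have hI0 : 0 < infoSH p := hε₀.trans_lt hε
  have hlub : IsLUB (achievable ε p) (optUtility ε p) :=
    isLUB_csSup ⟨_, hmem hM⟩ ⟨_, hbound⟩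
  have hup : optUtility ε p ≤ entHGivenS p + ε := hlub.2 hbound
  have hopt := hlub.1 (hmem hM)
  set β := ε / infoSH p with hβ
  have hβ0 : 0 ≤ β := div_nonneg hε₀ hI0.le
  have hβ1 : β < 1 := (div_lt_one hI0).2 hε
  have hgap : 0 ≤ gap p := add_nonneg (Real.logb_nonneg one_lt_two (by linarith)) (by norm_num)
  have hcost1 : couplingCost (labelWeight P k) M - infoSH p ≤ entSGivenH p := by linarith
  have hcost2 : couplingCost (labelWeight P k) M - infoSH p ≤ gap p := by
    unfold gap
    linarith
  have hL1 : L1 ε p ≤ optUtility ε p := by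
    unfold L1
    nlinarith
  have hgap_le : entHGivenS p + ε - (1 - β) * gap p ≤ optUtility ε p := by nlinarith
  have hgap_le' : entHGivenS p + ε - gap p ≤ optUtility ε p := by nlinarith
  refine ⟨hlub, hup, ?_, hL1, ?_, fun hne => (hL3 hne).trans hgap_le', fun hne => ?_, hzero,
    fun h0 => ?_, fun heq => ?_⟩
  · unfold L1
    linarith
  -- I ≤ H(S) gives α ≤ β, so weakening 1 - β to 1 - α only lowers the bound, and the term α
  -- H(S|h(X)) can be dropped.
  · have hα : ε / entS p ≤ β := div_le_div_of_nonneg_left hε₀ hI0 (by linarith)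
    have hα0 : 0 ≤ ε / entS p := div_nonneg hε₀ (by linarith)
    refine le_trans ?_ hgap_le
    unfold L2
    have h1 := mul_nonneg hα0 hSH0
    have h2 := mul_le_mul_of_nonneg_right hα hgap
    linarith
  · refine (hL4 hne).trans ?_
    rcases min_choice (entSGivenH p) (gap p) with h1 | h1
    · rw [h1]
      unfold L1 at hL1
      linarith
    · rw [h1]
      exact hgap_le'
  · have h1 : L1 ε p = entHGivenS p + ε := by
      unfold L1
      linarith
    have h2 : optUtility ε p = entHGivenS p + ε := le_antisymm hup (h1 ▸ hL1)
    exact ⟨h2.trans h1.symm, h2⟩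
  -- For the merging coupling, cost - I < H(S|h(X)). Since 0 < 1 - β ≤ 1, the achieved utility is
  -- strictly above `L1`.
  · by_contra hne
    obtain ⟨M', hM', hlt⟩ := hprod hne
    have h1 := hlub.1 (hmem hM')
    have h2 : couplingCost (labelWeight P k) M' - infoSH p < entSGivenH p := by linarith
    rw [heq] at h1
    unfold L1 at h1
    have h3 : 0 < entSGivenH p := lt_of_le_of_ne hSH0 (Ne.symm hne)
    nlinarith
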